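/- Let $G$ be a unimodular (Hausdorff, second countable) Lie group with Haar measure $\mu_G$, let $\mathcal A$ be a unital $C^*$-algebra, $U$ a homomorphism from $G$ to the unitary group of $\mathcal A$, and $\rho_0$ a state of $\mathcal A$ with GNS representation $\pi_{\rho_0}$ on $\mathcal H_{\rho_0}$. Assume that the unitary representation $U_0=\pi_{\rho_0}\circ U$ of $G$ on $\mathcal H_{\rho_0}$ is strongly continuous, irreducible and square integrable, i.e. $g\mapsto\langle\varphi,U_0(g)\psi\rangle$ is in $L^2(G,\mu_G)$ for some nonzero $\varphi,\psi$. Then $U_0$ has a formal degree $0<d<\infty$: all coefficient functions are in $L^2(G,\mu_G)$ and $$\int_G\langle\varphi_1,U_0(g)\psi_1\rangle\,\langle U_0(g)\psi_2,\varphi_2\rangle\,d\mu_G(g)=d^{-1}\langle\varphi_1,\varphi_2\rangle\langle\psi_2,\psi_1\rangle ,$$ (inner products are linear in the second argument). With $D_0(g)=d\,U_0(g)^\dagger$, acting as a functional by the trace pairing $\langle D_0(g),a\rangle=\mathrm{Tr}(D_0(g)a)$, the pair $(U_0,D_0)$ is a tomographic pair for the normal states of $\mathcal B(\mathcal H_{\rho_0})$,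 that is: 1. $U_0$ separates normal states: if $\sigma,\tau$ are density operators on $\mathcal H_{\rho_0}$ (positive, trace class, trace one) with $\mathrm{Tr}(\sigma U_0(g))=\mathrm{Tr}(\tau U_0(g))$ for all $g\in G$, then $\sigma=\tau$. 2. For every density operator $\sigma$ the smeared character $\chi_\sigma(g)=\mathrm{Tr}(\sigma U_0(g))$ is in $L^2(G,\mu_G)$, and for every trace class operator $a$ the function $g\mapsto\langle D_0(g),a\rangle$ is in $L^2(G,\mu_G)$. 3. The kernel $\kappa(g,g')=\langle D_0(g'),U_0(g)\rangle$ is reproducing, $\chi_\sigma(g)=\int_G\kappa(g,g')\chi_\sigma(g')\,d\mu_G(g')$ for every density operator $\sigma$, in the sense of distributions: for every $f\in C_c(G)$ there is $\kappa_f\in L^2(G,\mu_G)$ such that, for all $h\in C_c(G)$, the operator $\int h D_0\,d\mu_G\int fU_0\,d\mu_G$ (weak integrals) is trace class and $$\int_G h\,\kappa_f\,d\mu_G=\mathrm{Tr}\Big(\int_G h(g')D_0(g')\,d\mu_G(g')\int_G f(g)U_0(g)\,d\mu_G(g)\Big),$$ and $\int_G f\chi_\sigma\,d\mu_G=\int_G\kappa_f\,\chi_\sigma\,d\mu_G$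 for every density operator $\sigma$. 4. For every unit vector $\psi_0\in\mathcal H_{\rho_0}$ the kernel $\kappa_{\psi_0}(g,g')=d\,\langle U_0(g)\psi_0,U_0(g')\psi_0\rangle$ is reproducing pointwise on the functions $\Phi(g)=\langle U_0(g)\psi_0,\psi\rangle$, $\psi\in\mathcal H_{\rho_0}$: for every $g$ the integrand is integrable and $\Phi(g)=\int_G\kappa_{\psi_0}(g,g')\Phi(g')\,d\mu_G(g')$. If moreover $\mathcal H_{\rho_0}$ is finite dimensional, then $D_0$ takes values in the dual of the $C^*$-algebra $\mathcal B(\mathcal H_{\rho_0})$ and $(U_0,D_0)$ is a tomographic pair of this $C^*$-algebra in the pointwise sense: for all states $\rho$, $F_\rho=\rho(U_0(\cdot))$ is in $L^2(G,\mu_G)$, the $F_\rho$ separate states, $g\mapsto\|D_0(g)\|$ is in $L^2(G,\mu_G)$, and for every $g$ the function $g'\mapsto\kappa(g,g')F_\rho(g')$ is integrable with $F_\rho(g)=\int_G\kappa(g,g')F_\rho(g')\,d\mu_G(g')$; also the pair is normalized, $\int_G F_\rho(g)\langle D_0(g),\mathbb 1\rangle\,d\mu_G(g)=1$. -/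

import Mathlib

open MeasureTheory
open scoped ComplexOrder InnerProductSpace ContDiff Manifold

namespace GroupTomography

noncomputable section

/-! ### Tomographic maps and pairs on a C*-algebra -/

section CStar

variable {M : Type*} [MeasurableSpace M]
variable {A : Type*} [CStarAlgebra A] [PartialOrder A] [StarOrderedRing A]

/-- A state is a positive linear functional with value `1` at the unit. -/
def IsState (ρ : A →ₚ[ℂ] ℂ) : Prop := ρ 1 = 1

/-- A tomographic map: all sampling functions `x ↦ ρ (U x)` of states are square integrable, and
they separate states. -/
structure IsTomographicMap (μ : Measure M) (U : M → A) : Prop where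
  memLp : ∀ ρ : A →ₚ[ℂ] ℂ, IsState ρ → MemLp (fun x => ρ (U x)) 2 μ
  separates : ∀ ρ τ : A →ₚ[ℂ] ℂ, IsState ρ → IsState τ → (∀ x, ρ (U x) = τ (U x)) → ρ = τ

/-- A tomographic pair `U : M → A`, `D : M → A'`, with kernel `κ (y, x) = D x (U y)`. -/
structure IsTomographicPair (μ : Measure M) (U : M → A) (D : M → StrongDual ℂ A) : Prop where
  tomographicMap : IsTomographicMap μ U
  norm_memLp : MemLp (fun x => ‖D x‖) 2 μ
  reproducing : ∀ ρ : A →ₚ[ℂ] ℂ, IsState ρ → ∀ y : M,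
    Integrable (fun x => D x (U y) * ρ (U x)) μ ∧ ∫ x, D x (U y) * ρ (U x) ∂μ = ρ (U y)

/-- The normalization condition of a tomographic pair. -/
def IsNormalized (μ : Measure M) (U : M → A) (D : M → StrongDual ℂ A) : Prop :=
  ∀ ρ : A →ₚ[ℂ] ℂ, IsState ρ → ∫ x, ρ (U x) * D x 1 ∂μ = 1

end CStar

/-! ### Trace class operators, density operators, weak integrals -/

section Operators

variable {H : Type*} [NormedAddCommGroup H] [InnerProductSpace ℂ H] [CompleteSpace H]

variable (H) in
/-- The index set of a chosen Hilbert basis of `H`. -/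
def basisIndex : Set H := (exists_hilbertBasis ℂ H).choose

variable (H) in
/-- A chosen Hilbert basis of `H`. -/
def someBasis : HilbertBasis (basisIndex H) ℂ H := (exists_hilbertBasis ℂ H).choose_spec.choose

/-- `T` is of trace class: `Tr |T| < ∞`, where `|T| = (T† T)^{1/2}`. -/
def IsTraceClass (T : H →L[ℂ] H) : Prop :=
  Summable fun i => (⟪someBasis H i, CFC.abs T (someBasis H i)⟫_ℂ).re

/-- The trace of an operator, meaningful for trace class operators, for which it does not depend
on the Hilbert basis. -/
def opTrace (T : H →L[ℂ] H) : ℂ := ∑' i, ⟪someBasis H i, T (someBasis H i)⟫_ℂ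

/-- Density operators: positive trace class operators of trace one. -/
structure IsDensityOperator (σ : H →L[ℂ] H) : Prop where
  isPositive : σ.IsPositive
  isTraceClass : IsTraceClass σ
  trace_eq_one : opTrace σ = 1

/-- `T = ∫ F x dμ(x)` in the weak sense. -/
def IsWeakIntegral {M : Type*} [MeasurableSpace M] (μ : Measure M) (F : M → H →L[ℂ] H)
    (T : H →L[ℂ] H) : Prop :=
  ∀ φ ψ : H, Integrable (fun x => ⟪φ, F x ψ⟫_ℂ) μ ∧ ∫ x, ⟪φ, F x ψ⟫_ℂ ∂μ = ⟪φ, T ψ⟫_ℂ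

end Operators

/-! ### Square integrable representations -/

section Representations

variable {G : Type*} [Group G] [MeasurableSpace G]
variable {H : Type*} [NormedAddCommGroup H] [InnerProductSpace ℂ H] [CompleteSpace H]

/-- Topological irreducibility: `H ≠ 0`, and the only closed invariant subspaces are `0`, `H`. -/
def IsIrreducibleRep (V : G →* unitary (H →L[ℂ] H)) : Prop :=
  Nontrivial H ∧ ∀ K : Submodule ℂ H, IsClosed (K : Set H) →
    (∀ g : G, ∀ ψ ∈ K, (V g : H →L[ℂ] H) ψ ∈ K) → K = ⊥ ∨ K = ⊤

/-- An irreducible unitary representation with a coefficient function of nonzero vectors in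
`L²`. -/
def IsSquareIntegrableRep (μ : Measure G) (V : G →* unitary (H →L[ℂ] H)) : Prop :=
  IsIrreducibleRep V ∧
    ∃ φ ψ : H, φ ≠ 0 ∧ ψ ≠ 0 ∧ MemLp (fun g => ⟪φ, (V g : H →L[ℂ] H) ψ⟫_ℂ) 2 μ

/-- `d` is the formal degree of `V`: all coefficient functions are square integrable, and the
orthogonality relations hold with constant `d⁻¹`. -/
structure IsFormalDegree (μ : Measure G) (V : G →* unitary (H →L[ℂ] H)) (d : ℝ) : Prop where
  pos : 0 < d
  memLp : ∀ φ ψ : H, MemLp (fun g => ⟪φ, (V g : H →L[ℂ] H) ψ⟫_ℂ) 2 μ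
  orthogonality : ∀ φ₁ φ₂ ψ₁ ψ₂ : H,
    ∫ g, ⟪φ₁, (V g : H →L[ℂ] H) ψ₁⟫_ℂ * ⟪(V g : H →L[ℂ] H) ψ₂, φ₂⟫_ℂ ∂μ
      = (d : ℂ)⁻¹ * (⟪φ₁, φ₂⟫_ℂ * ⟪ψ₂, ψ₁⟫_ℂ)

/-- The tomographic map of a unitary representation, with values in `B(H)`. -/
def tomographicMap (V : G →* unitary (H →L[ℂ] H)) (g : G) : H →L[ℂ] H := V g

/-- The dual tomographic map `g ↦ d V(g)†`. The operator `D g` acts as a functional through the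
trace pairing `⟨D g, a⟩ = Tr (D g a)`. -/
def dualMap (V : G →* unitary (H →L[ℂ] H)) (d : ℝ) (g : G) : H →L[ℂ] H :=
  (d : ℂ) • (V g : H →L[ℂ] H).adjoint

end Representations

/-! ### Tomographic pairs for normal states, with values in `B(H)` -/

section NormalStates

variable {M : Type*} [TopologicalSpace M] [MeasurableSpace M]
variable {H : Type*} [NormedAddCommGroup H] [InnerProductSpace ℂ H] [CompleteSpace H]

/-- The sampling function (smeared character) `x ↦ Tr (σ U(x))` of a density operator. -/
def smearedCharacter (U : M → H →L[ℂ] H) (σ : H →L[ℂ] H) (x : M) : ℂ := opTrace (σ * U x)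

/-- The kernel `κ (y, x) = ⟨D x, U y⟩ = Tr (D(x) U(y))` as a distribution: `k` is the `L²` function
`x ↦ ∫ f(y) κ(y, x) dμ(y)`, that is, for every test function `h`,
`∫ h(x) k(x) dμ(x) = Tr ((∫ h(x) D(x) dμ(x)) (∫ f(y) U(y) dμ(y)))`. -/
def IsSmearedKernel (μ : Measure M) (U D : M → H →L[ℂ] H) (f k : M → ℂ) : Prop :=
  MemLp k 2 μ ∧ ∀ h : M → ℂ, Continuous h → HasCompactSupport h →
    ∃ A B : H →L[ℂ] H, IsWeakIntegral μ (fun y => f y • U y) A ∧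
      IsWeakIntegral μ (fun x => h x • D x) B ∧
      IsTraceClass (B * A) ∧ ∫ x, h x * k x ∂μ = opTrace (B * A)

/-- A tomographic pair of operator valued maps for the normal states of `B(H)`. The functional
`a ↦ Tr (D(x) a)` is evaluated at trace class operators `a`, and the kernel is
reproducing in the sense of distributions. -/
structure IsNormalTomographicPair (μ : Measure M) (U D : M → H →L[ℂ] H) : Prop where
  /-- `U` separates the normal states. -/
  separates : ∀ σ τ : H →L[ℂ] H, IsDensityOperator σ → IsDensityOperator τ →
    (∀ x, smearedCharacter U σ x = smearedCharacter U τ x) → σ = τ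
  /-- The sampling functions are square integrable. -/
  memLp : ∀ σ : H →L[ℂ] H, IsDensityOperator σ → MemLp (smearedCharacter U σ) 2 μ
  /-- The functions `x ↦ ⟨D x, a⟩` are square integrable. -/
  dual_memLp : ∀ a : H →L[ℂ] H, IsTraceClass a → MemLp (fun x => opTrace (D x * a)) 2 μ
  /-- `Φ(y) = ∫ κ(y, x) Φ(x) dμ(x)` for every sampling function `Φ`, tested against `f`. -/
  reproducing : ∀ f : M → ℂ, Continuous f → HasCompactSupport f →
    ∃ k : M → ℂ, IsSmearedKernel μ U D f k ∧ ∀ σ : H →L[ℂ] H, IsDensityOperator σ →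
      ∫ y, f y * smearedCharacter U σ y ∂μ = ∫ x, k x * smearedCharacter U σ x ∂μ

end NormalStates

/-! ### The representation on the GNS space -/

section GNS

variable {G : Type*} [Group G]
variable {A : Type*} [CStarAlgebra A] [PartialOrder A] [StarOrderedRing A]

/-- The unitary representation `U₀ = π_ρ ∘ U` on the GNS space of `ρ`. -/
def gnsRep (ρ : A →ₚ[ℂ] ℂ) (U : G →* unitary A) : G →* unitary (ρ.GNS →L[ℂ] ρ.GNS) where
  toFun g := ⟨ρ.gnsStarAlgHom (U g : A), Unitary.map_mem ρ.gnsStarAlgHom (U g).2⟩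
  map_one' := Subtype.ext (by simp only [map_one, OneMemClass.coe_one])
  map_mul' g h := Subtype.ext (by simp only [map_mul, Submonoid.coe_mul])

end GNS

end

end GroupTomography

/-!
The proof rests on Schur's lemma and on the orthogonality relations, from which every part of the
statement is read off.

*Formal degree.* Fix `ψ` and consider the linear map `x ↦ ⟪V(·) ψ, x⟫` into `L²(G)`, defined on those
`x` for which the coefficient is square integrable. It is closed and intertwines `V` with left
translation, so the orthogonal projection onto its graph in `H ⊕ L²(G)` commutes with the group, and
the compression of this projection to `H` is a scalar by Schur's lemma for bounded operators. The
scalar is not zero as soon as one nonzero `x` lies in the domain, and then the map is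
everywhere defined and a multiple of an isometry (`IsIrreducibleRep.exists_integral_coeff`). This
way no unbounded operators appear. Since `G` is unimodular, `μ` is invariant under inversion, which
exchanges the two arguments of a coefficient; hence all coefficients are square integrable and the
constants `C(ψ)` are proportional to `‖ψ‖²`. Polarization gives the orthogonality relations
(`IsSquareIntegrableRep.exists_isFormalDegree`).

*Normal states.* By polar decomposition a trace class operator is a product `a = X Y` of
Hilbert–Schmidt operators, and cyclicity of the trace turns `Tr (a V(g))` into the series
`∑ ⟪Y† eⱼ, V(g) X eⱼ⟫`, which converges absolutely in `L²(G)`. Its inner products with coefficients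
are the matrix elements of `a`, up to `d⁻¹` (`IsTraceClass.inner_coeffMap_opTrace`); this gives
square integrability and separation. For `f ∈ L²(G)` the operator `A = ∫ f V dμ` is
Hilbert–Schmidt by a Bessel inequality for the orthogonal vectors `⟪A eⱼ, V(·) eⱼ⟫`, so that products
of two such operators are trace class. The smeared kernel of `f` is the conjugate of
the orthogonal projection of `f̄` onto the closed span of the coefficients, given by the series
`d ∑ ⟪A eⱼ, V(·) eⱼ⟫` (`isSmearedKernel_coeffProjection`). It is reproducing since the sampling
functions lie in this closed span.

*Finite dimension.* A linear functional `L` on `B(H)` is a finite combination of matrix elements, and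
the orthogonality relations give `∫ d Tr (V(g)† a) L(V(g)) dμ(g) = L a`
(`IsFormalDegree.integrable_and_integral_dualFunctional`), which is separation, the reproducing
property and normalization at once. The norm of the dual functional does not depend on `g`, and `μ`
is finite.
-/

namespace GroupTomography

/-! ### Hilbert–Schmidt and trace class operators -/

section HilbertSchmidt

/-- Parseval's identity. -/
theorem hasSum_sq_norm_inner {ι H : Type*} [NormedAddCommGroup H] [InnerProductSpace ℂ H]
    (b : HilbertBasis ι ℂ H) (x : H) :
    HasSum (fun i => ‖⟪b i, x⟫_ℂ‖ ^ 2) (‖x‖ ^ 2) := by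
  have h := b.hasSum_inner_mul_inner x x
  have h2 := Complex.reCLM.hasSum h
  convert h2 using 1
  · funext i
    simp only [Complex.reCLM_apply]
    rw [← inner_conj_symm x (b i), ← Complex.normSq_eq_conj_mul_self, Complex.ofReal_re,
      Complex.normSq_eq_norm_sq]
  · simp [inner_self_eq_norm_sq_to_K, ← Complex.ofReal_pow]

theorem summable_norm_mul_norm {ι E : Type*} [NormedAddCommGroup E] {u v : ι → E}
    (hu : Summable fun i => ‖u i‖ ^ 2) (hv : Summable fun i => ‖v i‖ ^ 2) :
    Summable fun i => ‖u i‖ * ‖v i‖ :=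
  Summable.of_nonneg_of_le (fun _ => by positivity)
    (fun i => by nlinarith [sq_nonneg (‖u i‖ - ‖v i‖), sq_nonneg (‖u i‖ + ‖v i‖)]) (hu.add hv)

variable {H : Type*} [NormedAddCommGroup H] [InnerProductSpace ℂ H] [CompleteSpace H]

/-- `T` is a Hilbert–Schmidt operator: `∑ ‖T eᵢ‖² < ∞` for the chosen Hilbert basis. -/
def IsHilbertSchmidt (T : H →L[ℂ] H) : Prop :=
  Summable fun i => ‖T (someBasis H i)‖ ^ 2

theorem IsHilbertSchmidt.summable_prod {T : H →L[ℂ] H} (hT : IsHilbertSchmidt T) :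
    Summable fun p : basisIndex H × basisIndex H =>
      ‖⟪someBasis H p.2, T (someBasis H p.1)⟫_ℂ‖ ^ 2 := by
  rw [summable_prod_of_nonneg (fun _ => by positivity)]
  refine ⟨fun i => (hasSum_sq_norm_inner (someBasis H) (T (someBasis H i))).summable, ?_⟩
  have h : ∀ i, ∑' j, ‖⟪someBasis H j, T (someBasis H i)⟫_ℂ‖ ^ 2 = ‖T (someBasis H i)‖ ^ 2 :=
    fun i => (hasSum_sq_norm_inner (someBasis H) _).tsum_eq
  simp only [h]
  exact hT

theorem IsHilbertSchmidt.adjoint {T : H →L[ℂ] H} (hT : IsHilbertSchmidt T) :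
    IsHilbertSchmidt T.adjoint := by
  have h := hT.summable_prod.prod_symm
  rw [summable_prod_of_nonneg (fun _ => by positivity)] at h
  have h' : ∀ j, ∑' i, ‖⟪someBasis H j, T (someBasis H i)⟫_ℂ‖ ^ 2
      = ‖T.adjoint (someBasis H j)‖ ^ 2 := fun j => by
    rw [← (hasSum_sq_norm_inner (someBasis H) (T.adjoint (someBasis H j))).tsum_eq]
    refine tsum_congr fun i => ?_
    rw [ContinuousLinearMap.adjoint_inner_right, norm_inner_symm]
  have h2 := h.2
  simp only [Prod.swap, h'] at h2
  exact h2

theorem IsHilbertSchmidt.mul_left {T : H →L[ℂ] H} (hT : IsHilbertSchmidt T) (A : H →L[ℂ] H) :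
    IsHilbertSchmidt (A * T) := by
  refine Summable.of_nonneg_of_le (fun _ => by positivity) (fun i => ?_)
    (Summable.mul_left (‖A‖ ^ 2) hT)
  rw [← mul_pow]
  exact pow_le_pow_left₀ (norm_nonneg _) (A.le_opNorm _) 2

theorem IsHilbertSchmidt.mul_right {T : H →L[ℂ] H} (hT : IsHilbertSchmidt T) (A : H →L[ℂ] H) :
    IsHilbertSchmidt (T * A) := by
  have h := (hT.adjoint.mul_left A.adjoint).adjoint
  simpa [← ContinuousLinearMap.star_eq_adjoint] using h

theorem IsHilbertSchmidt.summable_inner {S T : H →L[ℂ] H} (hS : IsHilbertSchmidt S)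
    (hT : IsHilbertSchmidt T) :
    Summable fun i => ⟪S (someBasis H i), T (someBasis H i)⟫_ℂ :=
  (summable_norm_mul_norm hS hT).of_norm_bounded fun _ => norm_inner_le_norm _ _

/-- Cyclicity of the trace, `Tr (S† T) = Tr (T S†)`, for Hilbert–Schmidt operators. -/
theorem IsHilbertSchmidt.hasSum_inner {S T : H →L[ℂ] H} (hS : IsHilbertSchmidt S)
    (hT : IsHilbertSchmidt T) :
    HasSum (fun j => ⟪T.adjoint (someBasis H j), S.adjoint (someBasis H j)⟫_ℂ)
      (∑' i, ⟪S (someBasis H i), T (someBasis H i)⟫_ℂ) := by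
  set e := someBasis H
  have hsum : Summable fun p : basisIndex H × basisIndex H =>
      ⟪S (e p.1), e p.2⟫_ℂ * ⟪e p.2, T (e p.1)⟫_ℂ := by
    refine (hS.summable_prod.add hT.summable_prod).of_norm_bounded fun p => ?_
    rw [norm_mul, norm_inner_symm (S _)]
    set a := ‖⟪e p.2, S (e p.1)⟫_ℂ‖
    set b := ‖⟪e p.2, T (e p.1)⟫_ℂ‖
    nlinarith [sq_nonneg (a - b), sq_nonneg (a + b)]
  have h1 : HasSum (fun i => ⟪S (e i), T (e i)⟫_ℂ)
      (∑' p : basisIndex H × basisIndex H, ⟪S (e p.1), e p.2⟫_ℂ * ⟪e p.2, T (e p.1)⟫_ℂ) :=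
    hsum.hasSum.prod_fiberwise fun i => e.hasSum_inner_mul_inner (S (e i)) (T (e i))
  rw [h1.tsum_eq]
  refine HasSum.prod_fiberwise ((Equiv.prodComm _ _).hasSum_iff.mpr hsum.hasSum) fun j => ?_
  have h := e.hasSum_inner_mul_inner (T.adjoint (e j)) (S.adjoint (e j))
  simp only [ContinuousLinearMap.adjoint_inner_left, ContinuousLinearMap.adjoint_inner_right] at h ⊢
  simp_rw [mul_comm ⟪e j, _⟫_ℂ] at h
  exact h

/-- A self-adjoint `P` with `P² = T† T` is related to `T` by a bounded operator: the
isometry `P x ↦ T x`, extended by continuity to the closure of the range of `P` and by zero to its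
orthogonal complement. -/
theorem exists_eq_mul_of_mul_self_eq {P T : H →L[ℂ] H} (hPsa : P.adjoint = P)
    (hPP : P * P = T.adjoint * T) : ∃ W : H →L[ℂ] H, T = W * P ∧ P = W.adjoint * T := by
  have hinner : ∀ x y, ⟪P x, P y⟫_ℂ = ⟪T x, T y⟫_ℂ := fun x y => by
    rw [← ContinuousLinearMap.adjoint_inner_right, hPsa, ← ContinuousLinearMap.adjoint_inner_right]
    exact congrArg (fun z => ⟪x, z⟫_ℂ) (DFunLike.congr_fun hPP y)
  have hnorm : ∀ x, ‖T x‖ = ‖P x‖ := fun x => by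
    rw [@norm_eq_sqrt_re_inner ℂ, @norm_eq_sqrt_re_inner ℂ _ _ _ _ (P x), hinner]
  obtain ⟨K, hK, e, he, hdense⟩ : ∃ (K : Submodule ℂ H) (_ : CompleteSpace K) (e : H →ₗ[ℂ] K),
      (∀ x, (e x : H) = P x) ∧ DenseRange e := by
    let K : Submodule ℂ H := (LinearMap.range (P : H →ₗ[ℂ] H)).topologicalClosure
    have hKmem : ∀ x, P x ∈ K := fun x =>
      Submodule.le_topologicalClosure _ (LinearMap.mem_range_self _ x)
    refine ⟨K, (Submodule.isClosed_topologicalClosure _).completeSpace_coe,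
      (P : H →ₗ[ℂ] H).codRestrict K hKmem, fun x => rfl, ?_⟩
    intro ⟨y, hy⟩
    rw [closure_subtype, ← Set.range_comp]
    exact hy
  have hb : ∃ C : ℝ, ∀ x, ‖(T : H →ₗ[ℂ] H) x‖ ≤ C * ‖e x‖ :=
    ⟨1, fun x => by rw [one_mul, ← Submodule.norm_coe, he]; exact (hnorm x).le⟩
  obtain ⟨W₀, hW₀⟩ : ∃ W₀ : K →L[ℂ] H, ∀ x, W₀ (e x) = T x :=
    ⟨(T : H →ₗ[ℂ] H).extendOfNorm e, LinearMap.extendOfNorm_eq hdense hb⟩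
  refine ⟨W₀ ∘L K.orthogonalProjectionOnto, ContinuousLinearMap.ext fun x => ?_,
    ContinuousLinearMap.ext fun x => ?_⟩
  · have h := congrArg W₀ (K.orthogonalProjectionOnto_mem_subspace_eq_self (e x))
    rw [hW₀, he] at h
    exact h.symm
  refine ext_inner_left ℂ fun z => ?_
  have key : ∀ y : K, ⟪(y : H), P x⟫_ℂ = ⟪W₀ y, T x⟫_ℂ := by
    intro y
    refine hdense.induction_on (p := fun y : K => ⟪(y : H), P x⟫_ℂ = ⟪W₀ y, T x⟫_ℂ) y
      (isClosed_eq (by fun_prop) (by fun_prop)) fun a => ?_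
    rw [hW₀ a, he]
    exact hinner a x
  have h1 := key (K.orthogonalProjectionOnto z)
  rw [← he x, ← Submodule.coe_inner, Submodule.inner_orthogonalProjectionOnto_eq_of_mem_right,
    he x] at h1
  rw [h1, mul_apply_eq_comp, ContinuousLinearMap.adjoint_inner_right]
  rfl

/-- Polar decomposition: `T = W |T|` and `|T| = W† T` for a bounded operator `W`. -/
theorem exists_polar_decomposition (T : H →L[ℂ] H) :
    ∃ W : H →L[ℂ] H, T = W * CFC.abs T ∧ CFC.abs T = W.adjoint * T :=
  exists_eq_mul_of_mul_self_eq (CFC.abs_nonneg T).isSelfAdjoint (CFC.abs_mul_abs T)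

theorem IsHilbertSchmidt.isTraceClass_mul {X Y : H →L[ℂ] H} (hX : IsHilbertSchmidt X)
    (hY : IsHilbertSchmidt Y) : IsTraceClass (X * Y) := by
  obtain ⟨W, -, hW⟩ := exists_polar_decomposition (X * Y)
  have h := Complex.reCLM.summable ((hX.adjoint.mul_right W).summable_inner hY)
  refine h.congr fun i => ?_
  simp only [Complex.reCLM_apply, hW]
  simp [ContinuousLinearMap.adjoint_inner_right, ContinuousLinearMap.adjoint_inner_left]

theorem IsTraceClass.exists_eq_mul {T : H →L[ℂ] H} (hT : IsTraceClass T) :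
    ∃ X Y : H →L[ℂ] H, IsHilbertSchmidt X ∧ IsHilbertSchmidt Y ∧ T = X * Y := by
  obtain ⟨W, hW, -⟩ := exists_polar_decomposition T
  set R : H →L[ℂ] H := CFC.sqrt (CFC.abs T) with hR
  have hRR : R * R = CFC.abs T := CFC.sqrt_mul_sqrt_self _ (CFC.abs_nonneg T)
  have hRsa : R.adjoint = R := (CFC.sqrt_nonneg (CFC.abs T)).isSelfAdjoint
  have hRhs : IsHilbertSchmidt R := by
    refine Summable.congr hT fun i => ?_
    rw [← hRR, @norm_sq_eq_re_inner ℂ, ← ContinuousLinearMap.adjoint_inner_right, hRsa]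
    rfl
  exact ⟨W * R, R, hRhs.mul_left W, hRhs, by rw [mul_assoc, hRR, ← hW]⟩

/-- The trace of `X Y A`, for Hilbert–Schmidt `X`, `Y` and bounded `A`, as a sum of
matrix elements of `A`. -/
theorem IsHilbertSchmidt.opTrace_mul_mul {X Y : H →L[ℂ] H} (hX : IsHilbertSchmidt X)
    (hY : IsHilbertSchmidt Y) (A : H →L[ℂ] H) :
    HasSum (fun j => ⟪Y.adjoint (someBasis H j), A (X (someBasis H j))⟫_ℂ)
      (opTrace (X * Y * A)) := by
  have h := hX.adjoint.hasSum_inner (hY.mul_right A)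
  have h1 : opTrace (X * Y * A)
      = ∑' i, ⟪X.adjoint (someBasis H i), (Y * A) (someBasis H i)⟫_ℂ := by
    refine tsum_congr fun i => ?_
    rw [ContinuousLinearMap.adjoint_inner_left]
    rfl
  rw [h1]
  convert h using 2 with j
  have h2 : (Y * A).adjoint = A.adjoint * Y.adjoint := star_mul Y A
  rw [h2, ContinuousLinearMap.adjoint_adjoint]
  exact (ContinuousLinearMap.adjoint_inner_left A (X (someBasis H j)) _).symm

theorem opTrace_adjoint (T : H →L[ℂ] H) :
    opTrace T.adjoint = starRingEnd ℂ (opTrace T) := by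
  unfold opTrace
  rw [← Complex.star_def, tsum_star]
  refine tsum_congr fun i => ?_
  rw [ContinuousLinearMap.adjoint_inner_right, ← inner_conj_symm]
  rfl

end HilbertSchmidt

/-! ### Schur's lemma -/

section Schur

variable {G : Type*} [Group G]
variable {H : Type*} [NormedAddCommGroup H] [InnerProductSpace ℂ H] [CompleteSpace H]

/-- **Schur's lemma** for self-adjoint operators: if the spectrum had two points, functions of `T`
supported on the two sides of their midpoint would have nontrivial invariant kernels. -/
theorem IsIrreducibleRep.exists_eq_smul_one {V : G →* unitary (H →L[ℂ] H)}
    (hV : IsIrreducibleRep V) {T : H →L[ℂ] H} (hT : IsSelfAdjoint T)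
    (hcomm : ∀ g, Commute (V g : H →L[ℂ] H) T) : ∃ c : ℝ, T = (c : ℂ) • (1 : H →L[ℂ] H) := by
  obtain ⟨hnt, hirr⟩ := hV
  -- the kernel of an operator commuting with `V` is closed and invariant
  have hker : ∀ S : H →L[ℂ] H, (∀ g, Commute (V g : H →L[ℂ] H) S) →
      (∀ x, S x = 0 → x = 0) ∨ S = 0 := by
    intro S hS
    have hinv : ∀ g, ∀ ψ ∈ LinearMap.ker (S : H →ₗ[ℂ] H),
        (V g : H →L[ℂ] H) ψ ∈ LinearMap.ker (S : H →ₗ[ℂ] H) := fun g ψ hψ => by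
      have h1 : S ((V g : H →L[ℂ] H) ψ) = (V g : H →L[ℂ] H) (S ψ) :=
        (DFunLike.congr_fun (hS g).eq ψ).symm
      have h2 : S ψ = 0 := hψ
      change S ((V g : H →L[ℂ] H) ψ) = 0
      rw [h1, h2, map_zero]
    rcases hirr _ S.isClosed_ker hinv with h | h
    · exact Or.inl fun x hx => by
        have : x ∈ LinearMap.ker (S : H →ₗ[ℂ] H) := hx
        rwa [h] at this
    · right
      ext x
      have : x ∈ LinearMap.ker (S : H →ₗ[ℂ] H) := h ▸ Submodule.mem_top
      exact this
  -- the positive and negative parts of `T - m` commute with `V`, and their product is zero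
  have hdich : ∀ m : ℝ, cfc (fun t : ℝ => max (t - m) 0) T = 0 ∨
      cfc (fun t : ℝ => max (m - t) 0) T = 0 := by
    intro m
    have hc : ∀ f : ℝ → ℝ, ∀ g, Commute (V g : H →L[ℂ] H) (cfc f T) := fun f g =>
      ((hcomm g).symm.cfc_real f).symm
    rcases hker (cfc (fun t : ℝ => max (t - m) 0) T) (hc _) with h | h
    · right
      ext x
      refine h _ ?_
      have hmul : cfc (fun t : ℝ => max (t - m) 0) T * cfc (fun t : ℝ => max (m - t) 0) T = 0 := by
        rw [← cfc_mul (fun t : ℝ => max (t - m) 0) (fun t : ℝ => max (m - t) 0) T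
          (by fun_prop) (by fun_prop)]
        have : (fun t : ℝ => max (t - m) 0 * max (m - t) 0) = fun _ => 0 := by
          funext t
          rcases le_total t m with h | h
          · rw [max_eq_right (by linarith : t - m ≤ 0), zero_mul]
          · rw [max_eq_right (by linarith : m - t ≤ 0), mul_zero]
        rw [this]
        exact cfc_const_zero ℝ T
      exact DFunLike.congr_fun hmul x
    · exact Or.inl h
  have hspec : (spectrum ℝ T).Subsingleton := by
    intro a ha b hb
    by_contra hab
    wlog hlt : a < b generalizing a b
    · exact this hb ha (Ne.symm hab) (lt_of_le_of_ne (not_lt.mp hlt) (Ne.symm hab))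
    have hmem : ∀ (f : ℝ → ℝ), Continuous f → cfc f T = 0 → ∀ t ∈ spectrum ℝ T, f t = 0 := by
      intro f hf h t ht
      have h1 : f t ∈ spectrum ℝ (cfc f T) := by
        rw [cfc_map_spectrum f T hT (by fun_prop)]
        exact ⟨t, ht, rfl⟩
      rw [h, spectrum.zero_eq] at h1
      exact h1
    rcases hdich ((a + b) / 2) with h | h
    · have := hmem _ (by fun_prop) h b hb
      rw [max_eq_left (by linarith)] at this
      linarith
    · have := hmem _ (by fun_prop) h a ha
      rw [max_eq_left (by linarith)] at this
      linarith
  obtain ⟨c, hc⟩ : (spectrum ℝ T).Nonempty :=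
    ContinuousFunctionalCalculus.spectrum_nonempty T hT
  refine ⟨c, ?_⟩
  conv_lhs => rw [← cfc_id' ℝ T]
  rw [cfc_congr (g := fun _ => c) fun t ht => hspec ht hc, cfc_const c T]
  ext x
  simp [Algebra.algebraMap_eq_smul_one]

end Schur

/-! ### Unimodular groups -/

section Unimodular

variable {G : Type*} [Group G] [TopologicalSpace G] [IsTopologicalGroup G]
  [LocallyCompactSpace G] [SecondCountableTopology G] [MeasurableSpace G] [BorelSpace G]

/-- A two-sided Haar measure is invariant under inversion: the image measure `c μ` is a left Haar
measure, and `c² = 1` since inversion is an involution. -/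
theorem isInvInvariant_of_isMulRightInvariant (μ : Measure G) [μ.IsHaarMeasure]
    [μ.IsMulRightInvariant] : μ.IsInvInvariant := by
  constructor
  let c : ENNReal := Measure.haarScalarFactor μ.inv μ
  have hc : μ.inv = c • μ := Measure.isMulLeftInvariant_eq_smul μ.inv μ
  have h2 : Measure.map Inv.inv (Measure.map Inv.inv μ) = c ^ 2 • μ := by
    rw [← Measure.inv_def μ, hc, Measure.map_smul, ← Measure.inv_def μ, hc, smul_smul, pow_two]
  have μeq : μ = c ^ 2 • μ := by
    rw [Measure.map_map continuous_inv.measurable continuous_inv.measurable] at h2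
    simpa only [inv_involutive, Function.Involutive.comp_self, Measure.map_id] using h2
  have K : TopologicalSpace.PositiveCompacts G := Classical.arbitrary _
  have h3 : c ^ 2 * μ K = 1 ^ 2 * μ K := by
    conv_rhs => rw [μeq]
    simp
  have h4 : c ^ 2 = 1 ^ 2 :=
    (ENNReal.mul_left_inj (Measure.measure_pos_of_nonempty_interior _ K.interior_nonempty).ne'
      K.isCompact.measure_lt_top.ne).1 h3
  have h5 : c = 1 := (ENNReal.pow_right_strictMono two_ne_zero).injective h4
  rw [hc, h5, one_smul]

end Unimodular

/-! ### The orthogonality relations -/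

section UnitaryRep

variable {G : Type*} [Group G]
variable {H : Type*} [NormedAddCommGroup H] [InnerProductSpace ℂ H] [CompleteSpace H]
  (V : G →* unitary (H →L[ℂ] H))

theorem rep_mul_apply (g h : G) (x : H) :
    (V (g * h) : H →L[ℂ] H) x = (V g : H →L[ℂ] H) ((V h : H →L[ℂ] H) x) := by
  rw [map_mul]; rfl

theorem rep_one_apply (x : H) : (V 1 : H →L[ℂ] H) x = x := by
  rw [map_one]; rfl

theorem rep_adjoint (g : G) : (V g : H →L[ℂ] H).adjoint = (V g⁻¹ : H →L[ℂ] H) := by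
  rw [map_inv]; rfl

theorem inner_rep_left (g : G) (x y : H) :
    ⟪(V g : H →L[ℂ] H) x, y⟫_ℂ = ⟪x, (V g⁻¹ : H →L[ℂ] H) y⟫_ℂ := by
  rw [← rep_adjoint, ContinuousLinearMap.adjoint_inner_right]

theorem inner_rep_right (g : G) (x y : H) :
    ⟪x, (V g : H →L[ℂ] H) y⟫_ℂ = ⟪(V g⁻¹ : H →L[ℂ] H) x, y⟫_ℂ := by
  rw [inner_rep_left, inv_inv]

theorem inner_rep_rep (g : G) (x y : H) :
    ⟪(V g : H →L[ℂ] H) x, (V g : H →L[ℂ] H) y⟫_ℂ = ⟪x, y⟫_ℂ := by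
  rw [inner_rep_left, ← rep_mul_apply, inv_mul_cancel, rep_one_apply]

theorem norm_rep_apply (g : G) (x : H) : ‖(V g : H →L[ℂ] H) x‖ = ‖x‖ := by
  rw [@norm_eq_sqrt_re_inner ℂ, inner_rep_rep, ← @norm_eq_sqrt_re_inner ℂ]

end UnitaryRep

section Compression

variable {G H : Type*} [MeasurableSpace G] {μ : Measure G} [NormedAddCommGroup H]
  [InnerProductSpace ℂ H]

/-- The orthogonal projection onto a subspace of `H ⊕ L²`, compressed to `H`. -/
noncomputable def graphCompression (Γ : Submodule ℂ (WithLp 2 (H × Lp ℂ 2 μ))) [Γ.HasOrthogonalProjection] :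
    H →L[ℂ] H :=
  ContinuousLinearMap.fst ℂ H (Lp ℂ 2 μ) ∘L
    (WithLp.prodContinuousLinearEquiv 2 ℂ H (Lp ℂ 2 μ) : _ →L[ℂ] _) ∘L Γ.starProjection ∘L
    ((WithLp.prodContinuousLinearEquiv 2 ℂ H (Lp ℂ 2 μ)).symm : _ →L[ℂ] _) ∘L
    ContinuousLinearMap.inl ℂ H (Lp ℂ 2 μ)

theorem graphCompression_apply (Γ : Submodule ℂ (WithLp 2 (H × Lp ℂ 2 μ)))
    [Γ.HasOrthogonalProjection] (x : H) :
    graphCompression Γ x = (Γ.starProjection (WithLp.toLp 2 (x, 0))).fst := rfl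

end Compression

section CoefficientGraph

variable {G : Type*} [Group G] [MeasurableSpace G]
variable {H : Type*} [NormedAddCommGroup H] [InnerProductSpace ℂ H] [CompleteSpace H]

/-- The graph of the partially defined linear map `x ↦ ⟪V(·) ψ, x⟫` from `H` to `L²(G)`. -/
noncomputable def coeffGraph (μ : Measure G) (V : G →* unitary (H →L[ℂ] H)) (ψ : H) :
    Submodule ℂ (WithLp 2 (H × Lp ℂ 2 μ)) where
  carrier := {p | p.snd =ᵐ[μ] fun g => ⟪(V g : H →L[ℂ] H) ψ, p.fst⟫_ℂ}
  add_mem' {p q} hp hq := by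
    simp only [Set.mem_ofPred_eq, WithLp.add_snd, WithLp.add_fst] at hp hq ⊢
    filter_upwards [hp, hq, Lp.coeFn_add p.snd q.snd] with g h1 h2 h3
    rw [h3, Pi.add_apply, h1, h2, inner_add_right]
  zero_mem' := by
    simp only [Set.mem_ofPred_eq, WithLp.zero_snd, WithLp.zero_fst, inner_zero_right]
    exact Lp.coeFn_zero ℂ 2 μ
  smul_mem' c p hp := by
    simp only [Set.mem_ofPred_eq, WithLp.smul_snd, WithLp.smul_fst] at hp ⊢
    filter_upwards [hp, Lp.coeFn_smul c p.snd] with g h1 h2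
    rw [h2, Pi.smul_apply, h1, inner_smul_right, smul_eq_mul]

variable {μ : Measure G} {V : G →* unitary (H →L[ℂ] H)} {ψ : H}

theorem mem_coeffGraph {p : WithLp 2 (H × Lp ℂ 2 μ)} :
    p ∈ coeffGraph μ V ψ ↔ p.snd =ᵐ[μ] fun g => ⟪(V g : H →L[ℂ] H) ψ, p.fst⟫_ℂ :=
  Iff.rfl

theorem isClosed_coeffGraph : IsClosed (coeffGraph μ V ψ : Set (WithLp 2 (H × Lp ℂ 2 μ))) := by
  refine IsSeqClosed.isClosed fun p q hp hpq => ?_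
  have hfst : Filter.Tendsto (fun n => (p n).fst) Filter.atTop (nhds q.fst) :=
    ((WithLp.prod_continuous_ofLp 2 H (Lp ℂ 2 μ)).fst.tendsto q).comp hpq
  have hsnd : Filter.Tendsto (fun n => (p n).snd) Filter.atTop (nhds q.snd) :=
    ((WithLp.prod_continuous_ofLp 2 H (Lp ℂ 2 μ)).snd.tendsto q).comp hpq
  obtain ⟨ns, hns, hlim⟩ := (tendstoInMeasure_of_tendsto_Lp hsnd).exists_seq_tendsto_ae
  have hall : ∀ᵐ g ∂μ, ∀ n, (p n).snd g = ⟪(V g : H →L[ℂ] H) ψ, (p n).fst⟫_ℂ :=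
    ae_all_iff.mpr fun n => hp n
  refine mem_coeffGraph.mpr ?_
  filter_upwards [hlim, hall] with g h1 h2
  refine tendsto_nhds_unique h1 ?_
  simp only [h2]
  exact (tendsto_const_nhds.inner hfst).comp hns.tendsto_atTop

variable [MeasurableMul G] [μ.IsMulLeftInvariant]

/-- The unitary representation on `H ⊕ L²(G)` given by `V` and left translation. -/
noncomputable def graphTranslation (μ : Measure G) [μ.IsMulLeftInvariant] (V : G →* unitary (H →L[ℂ] H)) (g : G)
    (p : WithLp 2 (H × Lp ℂ 2 μ)) : WithLp 2 (H × Lp ℂ 2 μ) :=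
  WithLp.toLp 2 ((V g : H →L[ℂ] H) p.fst,
    Lp.compMeasurePreservingₗᵢ ℂ (g⁻¹ * ·) (measurePreserving_mul_left μ g⁻¹) p.snd)

theorem coeFn_graphTranslation_snd (g : G) (p : WithLp 2 (H × Lp ℂ 2 μ)) :
    (graphTranslation μ V g p).snd =ᵐ[μ] fun h => p.snd (g⁻¹ * h) :=
  Lp.coeFn_compMeasurePreserving p.snd (measurePreserving_mul_left μ g⁻¹)

theorem graphTranslation_mem {p : WithLp 2 (H × Lp ℂ 2 μ)} (hp : p ∈ coeffGraph μ V ψ) (g : G) :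
    graphTranslation μ V g p ∈ coeffGraph μ V ψ := by
  refine mem_coeffGraph.mpr ?_
  have h1 := (measurePreserving_mul_left μ g⁻¹).quasiMeasurePreserving.ae_eq_comp hp
  filter_upwards [coeFn_graphTranslation_snd (V := V) g p, h1] with h h2 h3
  rw [h2]
  refine h3.trans ?_
  change ⟪(V (g⁻¹ * h) : H →L[ℂ] H) ψ, p.fst⟫_ℂ = ⟪(V h : H →L[ℂ] H) ψ, (V g : H →L[ℂ] H) p.fst⟫_ℂ
  rw [rep_mul_apply, inner_rep_left, inv_inv]

theorem inner_graphTranslation (g : G) (p q : WithLp 2 (H × Lp ℂ 2 μ)) :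
    ⟪graphTranslation μ V g p, q⟫_ℂ = ⟪p, graphTranslation μ V g⁻¹ q⟫_ℂ := by
  have hq : q = graphTranslation μ V g (graphTranslation μ V g⁻¹ q) := by
    refine WithLp.ofLp_injective 2 (Prod.ext ?_ ?_)
    · change q.fst = (V g : H →L[ℂ] H) ((V g⁻¹ : H →L[ℂ] H) q.fst)
      rw [← rep_mul_apply, mul_inv_cancel, rep_one_apply]
    · refine Lp.ext ?_
      have h1 := (measurePreserving_mul_left μ g⁻¹).quasiMeasurePreserving.ae_eq_comp
        (coeFn_graphTranslation_snd (V := V) g⁻¹ q)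
      filter_upwards [coeFn_graphTranslation_snd (V := V) g (graphTranslation μ V g⁻¹ q), h1]
        with h h2 h3
      refine Eq.symm (h2.trans (h3.trans ?_))
      simp
  conv_lhs => rw [hq]
  rw [WithLp.prod_inner_apply, WithLp.prod_inner_apply]
  exact congrArg₂ _ (inner_rep_rep V g _ _) (LinearIsometry.inner_map_map _ _ _)

/-- If one coefficient `⟪φ, V(·) ψ⟫` with `φ ≠ 0` of an irreducible representation is square
integrable, then all coefficients `⟪V(·) ψ, x⟫` are, and `x ↦ ⟪V(·) ψ, x⟫` is a multiple of an
isometry. The orthogonal projection `P` onto the graph of this map commutes with translations, so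
that its compression to `H` is a scalar `c` by Schur's lemma; `c ≠ 0` since the domain is not `0`.
Then `c⁻¹ P (x, 0)` is the point of the graph above `x`. -/
theorem IsIrreducibleRep.exists_integral_coeff (hV : IsIrreducibleRep V) {φ : H} (hφ : φ ≠ 0)
    (h2 : MemLp (fun g => ⟪φ, (V g : H →L[ℂ] H) ψ⟫_ℂ) 2 μ) :
    ∃ C : ℝ, (∀ x, MemLp (fun g => ⟪(V g : H →L[ℂ] H) ψ, x⟫_ℂ) 2 μ) ∧
      ∀ x y, ∫ g, ⟪y, (V g : H →L[ℂ] H) ψ⟫_ℂ * ⟪(V g : H →L[ℂ] H) ψ, x⟫_ℂ ∂μ = C * ⟪y, x⟫_ℂ := by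
  have : CompleteSpace (coeffGraph μ V ψ) := isClosed_coeffGraph.completeSpace_coe
  set Γ := coeffGraph μ V ψ with hΓ
  set T := graphCompression Γ with hTdef
  have hinl : ∀ x (p : WithLp 2 (H × Lp ℂ 2 μ)), ⟪WithLp.toLp 2 (x, 0), p⟫_ℂ = ⟪x, p.fst⟫_ℂ := by
    intro x p
    rw [WithLp.prod_inner_apply]
    simp
  have hT : ∀ x y, ⟪y, T x⟫_ℂ =
      ⟪Γ.starProjection (WithLp.toLp 2 (y, 0)), Γ.starProjection (WithLp.toLp 2 (x, 0))⟫_ℂ := by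
    intro x y
    rw [graphCompression_apply, ← hinl, Submodule.inner_starProjection_left_eq_right,
      Submodule.starProjection_eq_self_iff.mpr (Submodule.starProjection_apply_mem _ _)]
  have hTsa : IsSelfAdjoint T := by
    rw [ContinuousLinearMap.isSelfAdjoint_iff_isSymmetric]
    intro x y
    change ⟪T x, y⟫_ℂ = ⟪x, T y⟫_ℂ
    rw [hT, ← inner_conj_symm, hT, inner_conj_symm]
  have hcomm : ∀ g, Commute (V g : H →L[ℂ] H) T := by
    intro g
    ext x
    change (V g : H →L[ℂ] H) (T x) = T ((V g : H →L[ℂ] H) x)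
    rw [graphCompression_apply, graphCompression_apply]
    have h := Submodule.eq_starProjection_of_mem_of_inner_eq_zero (K := Γ)
      (u := graphTranslation μ V g (WithLp.toLp 2 (x, 0)))
      (v := graphTranslation μ V g (Γ.starProjection (WithLp.toLp 2 (x, 0))))
      (graphTranslation_mem (Submodule.starProjection_apply_mem _ _) g) (fun w hw => by
        rw [inner_sub_left, inner_graphTranslation, inner_graphTranslation, ← inner_sub_left]
        exact Submodule.starProjection_inner_eq_zero _ _ (graphTranslation_mem hw _))
    have h0 : graphTranslation μ V g (WithLp.toLp 2 (x, 0))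
        = WithLp.toLp 2 ((V g : H →L[ℂ] H) x, 0) := by
      refine WithLp.ofLp_injective 2 (Prod.ext rfl ?_)
      exact map_zero (Lp.compMeasurePreservingₗᵢ ℂ (g⁻¹ * ·) (measurePreserving_mul_left μ g⁻¹))
    rw [h0] at h
    rw [h]
    rfl
  obtain ⟨c, hc⟩ := hV.exists_eq_smul_one hTsa hcomm
  have hcx : ∀ x, T x = (c : ℂ) • x := fun x => by rw [hc]; rfl
  have h2' : MemLp (fun g => ⟪(V g : H →L[ℂ] H) ψ, φ⟫_ℂ) 2 μ := by
    refine (memLp_congr_ae (ae_of_all _ fun g => ?_)).mp h2.star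
    exact inner_conj_symm _ _
  have hc0 : c ≠ 0 := by
    rintro rfl
    have hP : ∀ x, Γ.starProjection (WithLp.toLp 2 (x, 0)) = 0 := fun x => by
      rw [← inner_self_eq_zero (𝕜 := ℂ), ← hT, hcx]
      simp
    have hmem : WithLp.toLp 2 (φ, h2'.toLp _) ∈ Γ := mem_coeffGraph.mpr h2'.coeFn_toLp
    have h := hinl φ (WithLp.toLp 2 (φ, h2'.toLp _))
    rw [← Submodule.starProjection_eq_self_iff.mpr hmem,
      ← Submodule.inner_starProjection_left_eq_right, hP, inner_zero_left,
      Submodule.starProjection_eq_self_iff.mpr hmem] at h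
    exact hφ (inner_self_eq_zero.mp h.symm)
  have hPmem : ∀ x, (c : ℂ)⁻¹ • Γ.starProjection (WithLp.toLp 2 (x, 0)) ∈ Γ := fun x =>
    Γ.smul_mem _ (Submodule.starProjection_apply_mem _ _)
  have hPfst : ∀ x, ((c : ℂ)⁻¹ • Γ.starProjection (WithLp.toLp 2 (x, 0))).fst = x := fun x => by
    rw [WithLp.smul_fst, ← graphCompression_apply, ← hTdef, hcx, smul_smul,
      inv_mul_cancel₀ (by exact_mod_cast hc0), one_smul]
  have hPsnd : ∀ x, ((c : ℂ)⁻¹ • Γ.starProjection (WithLp.toLp 2 (x, 0))).snd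
      =ᵐ[μ] fun g => ⟪(V g : H →L[ℂ] H) ψ, x⟫_ℂ := fun x => by
    have h := mem_coeffGraph.mp (hPmem x)
    rwa [hPfst] at h
  refine ⟨c⁻¹ - 1, fun x => (memLp_congr_ae (hPsnd x)).mp (Lp.memLp _), fun x y => ?_⟩
  have hin : ⟪(c : ℂ)⁻¹ • Γ.starProjection (WithLp.toLp 2 (y, 0)),
      (c : ℂ)⁻¹ • Γ.starProjection (WithLp.toLp 2 (x, 0))⟫_ℂ = (c : ℂ)⁻¹ * ⟪y, x⟫_ℂ := by
    rw [inner_smul_left, inner_smul_right, ← hT, hcx, inner_smul_right]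
    have : (c : ℂ) ≠ 0 := by exact_mod_cast hc0
    simp only [map_inv₀, Complex.conj_ofReal]
    field_simp
  rw [WithLp.prod_inner_apply] at hin
  have hint : ∫ g, ⟪y, (V g : H →L[ℂ] H) ψ⟫_ℂ * ⟪(V g : H →L[ℂ] H) ψ, x⟫_ℂ ∂μ =
      ⟪((c : ℂ)⁻¹ • Γ.starProjection (WithLp.toLp 2 (y, 0))).snd,
        ((c : ℂ)⁻¹ • Γ.starProjection (WithLp.toLp 2 (x, 0))).snd⟫_ℂ := by
    rw [L2.inner_def]
    refine integral_congr_ae ?_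
    filter_upwards [hPsnd x, hPsnd y] with g h1 h2
    rw [h1, h2, RCLike.inner_apply, inner_conj_symm, mul_comm]
  have h3 : ⟪((c : ℂ)⁻¹ • Γ.starProjection (WithLp.toLp 2 (y, 0))).fst,
        ((c : ℂ)⁻¹ • Γ.starProjection (WithLp.toLp 2 (x, 0))).fst⟫_ℂ = ⟪y, x⟫_ℂ := by
    rw [hPfst, hPfst]
  rw [hint]
  push_cast
  rw [sub_mul, one_mul, ← hin]
  exact eq_sub_of_add_eq' (congrArg (· + _) h3.symm)

end CoefficientGraph

section FormalDegree

/-- Polarization: a sesquilinear function vanishing on the diagonal is zero. -/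
theorem sesquilinear_eq_zero_of_diag {H : Type*} [AddCommGroup H] [Module ℂ H] {B : H → H → ℂ}
    (add_left : ∀ a b x, B (a + b) x = B a x + B b x)
    (add_right : ∀ x a b, B x (a + b) = B x a + B x b)
    (smul_left : ∀ (c : ℂ) a x, B (c • a) x = starRingEnd ℂ c * B a x)
    (smul_right : ∀ (c : ℂ) x a, B x (c • a) = c * B x a)
    (diag : ∀ a, B a a = 0) (a b : H) : B a b = 0 := by
  have hanti : ∀ a b, B a b = - B b a := fun a b => by
    have h := diag (a + b)
    rw [add_left, add_right, add_right, diag, diag] at h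
    linear_combination h
  have h1 := hanti (Complex.I • a) b
  rw [smul_left, smul_right, Complex.conj_I] at h1
  have h2 : B a b = B b a := by
    have := mul_left_cancel₀ (neg_ne_zero.mpr Complex.I_ne_zero) (h1.trans (neg_mul _ _).symm)
    exact this
  have h3 := hanti a b
  rw [← h2] at h3
  linear_combination h3 / 2

variable {G : Type*} [Group G] [TopologicalSpace G] [IsTopologicalGroup G]
  [MeasurableSpace G] [BorelSpace G] {μ : Measure G}
  [μ.IsHaarMeasure] [μ.IsInvInvariant]
variable {H : Type*} [NormedAddCommGroup H] [InnerProductSpace ℂ H] [CompleteSpace H]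

/-- A square integrable irreducible representation of a unimodular group has a formal degree. -/
theorem IsSquareIntegrableRep.exists_isFormalDegree {V : G →* unitary (H →L[ℂ] H)}
    (hcont : ∀ ψ : H, Continuous fun g => (V g : H →L[ℂ] H) ψ) (hV : IsSquareIntegrableRep μ V) :
    ∃ d : ℝ, IsFormalDegree μ V d := by
  obtain ⟨hirr, φ₀, ψ₀, hφ₀, hψ₀, hsq⟩ := hV
  -- inversion exchanges the two arguments of a coefficient
  have hswap : ∀ x y, MemLp (fun g => ⟪(V g : H →L[ℂ] H) x, y⟫_ℂ) 2 μ →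
      MemLp (fun g => ⟪x, (V g : H →L[ℂ] H) y⟫_ℂ) 2 μ := fun x y h => by
    have h' := h.comp_measurePreserving (Measure.measurePreserving_inv μ)
    refine (memLp_congr_ae (ae_of_all _ fun g => ?_)).mp h'
    exact (inner_rep_right V g x y).symm
  obtain ⟨-, hψ₀', -⟩ := hirr.exists_integral_coeff hφ₀ hsq
  have hex : ∀ x, ∃ C : ℝ, (∀ y, MemLp (fun g => ⟪(V g : H →L[ℂ] H) x, y⟫_ℂ) 2 μ) ∧
      ∀ y z, ∫ g, ⟪z, (V g : H →L[ℂ] H) x⟫_ℂ * ⟪(V g : H →L[ℂ] H) x, y⟫_ℂ ∂μ = C * ⟪z, y⟫_ℂ :=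
    fun x => hirr.exists_integral_coeff hψ₀ (hswap _ _ (hψ₀' x))
  choose C hC1 hC2 using hex
  have hmem : ∀ φ ψ, MemLp (fun g => ⟪φ, (V g : H →L[ℂ] H) ψ⟫_ℂ) 2 μ := fun φ ψ =>
    hswap φ ψ (hC1 φ ψ)
  have hsymm : ∀ x y : H, (C x : ℂ) * ⟪y, y⟫_ℂ = C y * ⟪x, x⟫_ℂ := fun x y => by
    rw [← hC2, ← hC2, ← integral_inv_eq_self _ μ]
    refine integral_congr_ae (ae_of_all _ fun g => ?_)
    simp only
    rw [inner_rep_right V g⁻¹ y x, inner_rep_left V g⁻¹ x y, inv_inv, mul_comm]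
  have := hirr.1
  obtain ⟨e, he⟩ := exists_norm_eq H zero_le_one
  have hee : ⟪e, e⟫_ℂ = 1 := by rw [inner_self_eq_norm_sq_to_K, he]; simp
  have hCx : ∀ x, (C x : ℂ) = C e * ⟪x, x⟫_ℂ := fun x => by rw [← hsymm x e, hee, mul_one]
  have hpos : 0 < C e := by
    have h1 : ∫ g, ‖⟪e, (V g : H →L[ℂ] H) e⟫_ℂ‖ ^ 2 ∂μ = C e := by
      have h := hC2 e e e
      rw [hee, mul_one] at h
      rw [← Complex.ofReal_inj, ← h, ← integral_complex_ofReal]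
      refine integral_congr_ae (ae_of_all _ fun g => ?_)
      simp only
      rw [← inner_conj_symm ((V g : H →L[ℂ] H) e) e, Complex.mul_conj, Complex.normSq_eq_norm_sq]
    have h0 : 0 ≤ C e := h1 ▸ integral_nonneg fun g => by positivity
    refine lt_of_le_of_ne h0 fun hz => ?_
    rw [← hz, integral_eq_zero_iff_of_nonneg (fun g => by positivity)
      ((memLp_two_iff_integrable_sq_norm (hmem e e).1).mp (hmem e e))] at h1
    have h2 : (fun g => ‖⟪e, (V g : H →L[ℂ] H) e⟫_ℂ‖ ^ 2) = fun _ => (0 : ℝ) :=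
      (Continuous.ae_eq_iff_eq μ ((continuous_const.inner (hcont e)).norm.pow 2)
        continuous_const).mp h1
    have h3 := congrFun h2 1
    simp only [rep_one_apply, hee] at h3
    norm_num at h3
  refine ⟨(C e)⁻¹, inv_pos.mpr hpos, hmem, fun φ₁ φ₂ ψ₁ ψ₂ => ?_⟩
  have hmem' : ∀ φ ψ, MemLp (fun g => ⟪(V g : H →L[ℂ] H) ψ, φ⟫_ℂ) 2 μ := fun φ ψ => hC1 ψ φ
  have hint : ∀ φ₁ φ₂ a b, Integrable (fun g => ⟪φ₁, (V g : H →L[ℂ] H) b⟫_ℂ *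
      ⟪(V g : H →L[ℂ] H) a, φ₂⟫_ℂ) μ := fun φ₁ φ₂ a b => (hmem φ₁ b).integrable_mul (hmem' φ₂ a)
  have hB := sesquilinear_eq_zero_of_diag
    (B := fun a b => ∫ g, ⟪φ₁, (V g : H →L[ℂ] H) b⟫_ℂ * ⟪(V g : H →L[ℂ] H) a, φ₂⟫_ℂ ∂μ
      - C e * (⟪φ₁, φ₂⟫_ℂ * ⟪a, b⟫_ℂ))
    (fun a b x => by
      simp only [map_add, inner_add_left, mul_add]
      rw [integral_add (hint _ _ _ _) (hint _ _ _ _)]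
      ring)
    (fun x a b => by
      simp only [map_add, inner_add_right, mul_add, add_mul]
      rw [integral_add (hint _ _ _ _) (hint _ _ _ _)]
      ring)
    (fun c a x => by
      simp only [map_smul, inner_smul_left, mul_left_comm _ (starRingEnd ℂ c)]
      rw [integral_const_mul]
      ring)
    (fun c x a => by
      simp only [map_smul, inner_smul_right, mul_assoc, mul_left_comm _ c]
      rw [integral_const_mul]
      ring)
    (fun a => by
      rw [hC2, hCx]
      ring) ψ₂ ψ₁
  simpa using sub_eq_zero.mp hB

end FormalDegree

/-! ### The coefficient map into `L²(G)` -/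

section CoeffMap

variable {G : Type*} [Group G] [MeasurableSpace G] {μ : Measure G}
variable {H : Type*} [NormedAddCommGroup H] [InnerProductSpace ℂ H] [CompleteSpace H]
  {V : G →* unitary (H →L[ℂ] H)} {d : ℝ}

theorem IsFormalDegree.memLp_inner_left (hd : IsFormalDegree μ V d) (x y : H) :
    MemLp (fun g => ⟪(V g : H →L[ℂ] H) y, x⟫_ℂ) 2 μ := by
  refine (memLp_congr_ae (ae_of_all _ fun g => ?_)).mp (hd.memLp x y).star
  exact inner_conj_symm _ _

theorem IsFormalDegree.inner_toLp (hd : IsFormalDegree μ V d) (φ₁ φ₂ ψ₁ ψ₂ : H) :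
    ⟪(hd.memLp φ₂ ψ₂).toLp _, (hd.memLp φ₁ ψ₁).toLp _⟫_ℂ
      = (d : ℂ)⁻¹ * (⟪φ₁, φ₂⟫_ℂ * ⟪ψ₂, ψ₁⟫_ℂ) := by
  rw [← hd.orthogonality, L2.inner_def]
  refine integral_congr_ae ?_
  filter_upwards [(hd.memLp φ₁ ψ₁).coeFn_toLp, (hd.memLp φ₂ ψ₂).coeFn_toLp] with g h1 h2
  rw [h1, h2, RCLike.inner_apply, inner_conj_symm]

theorem IsFormalDegree.norm_toLp (hd : IsFormalDegree μ V d) (φ ψ : H) :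
    ‖(hd.memLp φ ψ).toLp _‖ = √d⁻¹ * ‖φ‖ * ‖ψ‖ := by
  rw [← sq_eq_sq₀ (norm_nonneg _) (by positivity), mul_pow, mul_pow,
    Real.sq_sqrt (inv_nonneg.mpr hd.pos.le), ← Complex.ofReal_inj]
  have h := hd.inner_toLp φ φ ψ ψ
  simp only [inner_self_eq_norm_sq_to_K] at h
  push_cast
  rw [mul_assoc]
  exact h

/-- The coefficients `⟪φ, V(·) ψ⟫` of a representation with a formal degree, as a bounded
sesquilinear map with values in `L²(G)`. -/
noncomputable def coeffMap (hd : IsFormalDegree μ V d) : H →L⋆[ℂ] H →L[ℂ] Lp ℂ 2 μ :=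
  LinearMap.mkContinuous₂
    (LinearMap.mk₂'ₛₗ (starRingEnd ℂ) (RingHom.id ℂ) (fun φ ψ => (hd.memLp φ ψ).toLp _)
      (fun φ₁ φ₂ ψ => by
        rw [← MemLp.toLp_add]
        exact MemLp.toLp_congr _ _ (ae_of_all _ fun g => inner_add_left _ _ _))
      (fun c φ ψ => by
        rw [← MemLp.toLp_const_smul]
        exact MemLp.toLp_congr _ _ (ae_of_all _ fun g => inner_smul_left _ _ _))
      (fun φ ψ₁ ψ₂ => by
        rw [← MemLp.toLp_add]
        refine MemLp.toLp_congr _ _ (ae_of_all _ fun g => ?_)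
        simp only [map_add, inner_add_right, Pi.add_apply])
      (fun c φ ψ => by
        rw [← MemLp.toLp_const_smul]
        refine MemLp.toLp_congr _ _ (ae_of_all _ fun g => ?_)
        simp only [map_smul, inner_smul_right, Pi.smul_apply, RingHom.id_apply, smul_eq_mul]))
    (√d⁻¹) (fun φ ψ => (hd.norm_toLp φ ψ).le)

variable (hd : IsFormalDegree μ V d)

theorem coeFn_coeffMap (φ ψ : H) :
    coeffMap hd φ ψ =ᵐ[μ] fun g => ⟪φ, (V g : H →L[ℂ] H) ψ⟫_ℂ := (hd.memLp φ ψ).coeFn_toLp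

theorem inner_coeffMap (φ₁ φ₂ ψ₁ ψ₂ : H) :
    ⟪coeffMap hd φ₂ ψ₂, coeffMap hd φ₁ ψ₁⟫_ℂ = (d : ℂ)⁻¹ * (⟪φ₁, φ₂⟫_ℂ * ⟪ψ₂, ψ₁⟫_ℂ) :=
  hd.inner_toLp φ₁ φ₂ ψ₁ ψ₂

theorem norm_coeffMap (φ ψ : H) : ‖coeffMap hd φ ψ‖ = √d⁻¹ * ‖φ‖ * ‖ψ‖ := hd.norm_toLp φ ψ

/-- A series of coefficients that converges absolutely in `L²(G)` converges to its pointwise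
sum. -/
theorem exists_memLp_hasSum_coeffMap {ι : Type*} {u v : ι → H}
    (huv : Summable fun j => ‖u j‖ * ‖v j‖) :
    ∃ h : MemLp (fun g => ∑' j, ⟪u j, (V g : H →L[ℂ] H) (v j)⟫_ℂ) 2 μ,
      HasSum (fun j => coeffMap hd (u j) (v j)) (h.toLp _) := by
  -- all but countably many terms vanish
  set s : Set ι := Function.support fun j => ‖u j‖ * ‖v j‖ with hs
  have : Countable s := huv.countable_support
  have hnot : ∀ j ∉ s, u j = 0 ∨ v j = 0 := fun j hj => by
    simpa [hs, or_iff_not_imp_left] using hj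
  have hnorm : Summable fun j => ‖coeffMap hd (u j) (v j)‖ := by
    simp only [norm_coeffMap, mul_assoc]
    exact huv.mul_left _
  have hsupp : Function.support (fun j => coeffMap hd (u j) (v j)) ⊆ s := by
    refine Function.support_subset_iff'.mpr fun j hj => ?_
    rcases hnot j hj with h | h <;> simp [h]
  have htop : ∑' j : s, ‖coeffMap hd (u j) (v j)‖ₑ ≠ ⊤ :=
    tsum_enorm_ne_top_iff_summable_norm.mpr (hnorm.subtype s)
  have hae : ∀ᵐ g ∂μ, ∀ j : s, coeffMap hd (u j) (v j) g = ⟪u j, (V g : H →L[ℂ] H) (v j)⟫_ℂ :=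
    ae_all_iff.mpr fun j => coeFn_coeffMap hd _ _
  have heq : (∑' j : s, coeffMap hd (u j) (v j) : Lp ℂ 2 μ)
      =ᵐ[μ] fun g => ∑' j, ⟪u j, (V g : H →L[ℂ] H) (v j)⟫_ℂ := by
    filter_upwards [Lp.hasSum_coeFn_tsum htop, hae] with g h1 h2
    rw [← h1.tsum_eq, tsum_congr h2]
    refine tsum_subtype_eq_of_support_subset (f := fun j => ⟪u j, (V g : H →L[ℂ] H) (v j)⟫_ℂ)
      (Function.support_subset_iff'.mpr fun j hj => ?_)
    rcases hnot j hj with h | h <;> simp [h]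
  have hmem := (memLp_congr_ae heq).mp (Lp.memLp _)
  refine ⟨hmem, ?_⟩
  have h3 : (hmem.toLp _ : Lp ℂ 2 μ) = ∑' j : s, coeffMap hd (u j) (v j) :=
    Lp.ext (hmem.coeFn_toLp.trans heq.symm)
  rw [h3]
  exact (hasSum_subtype_iff_of_support_subset hsupp).mp (hnorm.subtype s).of_norm.hasSum

/-- The sampling functions `Tr (a V(·))` of trace class operators `a = X Y` as series of
coefficients in `L²(G)`. -/
theorem IsHilbertSchmidt.exists_memLp_opTrace {X Y : H →L[ℂ] H} (hX : IsHilbertSchmidt X)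
    (hY : IsHilbertSchmidt Y) :
    ∃ h : MemLp (fun g => opTrace (X * Y * (V g : H →L[ℂ] H))) 2 μ,
      HasSum (fun j => coeffMap hd (Y.adjoint (someBasis H j)) (X (someBasis H j)))
        (h.toLp _) := by
  obtain ⟨h1, h2⟩ := exists_memLp_hasSum_coeffMap hd (summable_norm_mul_norm hY.adjoint hX)
  have he : (fun g => ∑' j, ⟪Y.adjoint (someBasis H j), (V g : H →L[ℂ] H) (X (someBasis H j))⟫_ℂ)
      = fun g => opTrace (X * Y * (V g : H →L[ℂ] H)) :=
    funext fun g => (hX.opTrace_mul_mul hY _).tsum_eq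
  refine ⟨he ▸ h1, ?_⟩
  convert h2 using 1
  exact MemLp.toLp_congr _ _ (ae_of_all _ fun g => (congrFun he g).symm)

/-- The sampling function of a trace class operator determines its matrix elements. -/
theorem IsTraceClass.inner_coeffMap_opTrace {a : H →L[ℂ] H} (ha : IsTraceClass a) :
    ∃ h : MemLp (fun g => opTrace (a * (V g : H →L[ℂ] H))) 2 μ,
      ∀ x y, ⟪coeffMap hd x y, h.toLp _⟫_ℂ = (d : ℂ)⁻¹ * ⟪y, a x⟫_ℂ := by
  obtain ⟨X, Y, hX, hY, rfl⟩ := ha.exists_eq_mul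
  obtain ⟨h1, h2⟩ := hX.exists_memLp_opTrace hd hY
  refine ⟨h1, fun x y => ?_⟩
  have h3 := h2.mapL (innerSL ℂ (coeffMap hd x y))
  simp only [innerSL_apply_apply, inner_coeffMap, ContinuousLinearMap.adjoint_inner_left] at h3
  refine h3.unique (HasSum.mul_left _ ?_)
  have h4 := (someBasis H).hasSum_inner_mul_inner (X.adjoint y) (Y x)
  simp only [ContinuousLinearMap.adjoint_inner_left] at h4
  simp_rw [mul_comm ⟪y, _⟫_ℂ] at h4
  exact h4

end CoeffMap

/-! ### Tomographic pairs for normal states -/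

section Smearing

variable {G : Type*} [Group G] [MeasurableSpace G] {μ : Measure G}
variable {H : Type*} [NormedAddCommGroup H] [InnerProductSpace ℂ H] [CompleteSpace H]
  {V : G →* unitary (H →L[ℂ] H)} {d : ℝ} (hd : IsFormalDegree μ V d)

/-- The operator `∫ F̄(g) V(g) dμ(g)` of a square integrable function `F`, defined by its matrix
elements `⟪F, ⟪φ, V(·) ψ⟫⟫`. -/
noncomputable def smearedRep (F : Lp ℂ 2 μ) : H →L[ℂ] H :=
  (InnerProductSpace.continuousLinearMapOfBilin
    ((ContinuousLinearMap.compL ℂ H (Lp ℂ 2 μ) ℂ (innerSL ℂ F)).comp (coeffMap hd))).adjoint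

theorem inner_smearedRep (F : Lp ℂ 2 μ) (φ ψ : H) :
    ⟪φ, smearedRep hd F ψ⟫_ℂ = ⟪F, coeffMap hd φ ψ⟫_ℂ := by
  rw [smearedRep, ContinuousLinearMap.adjoint_inner_right,
    InnerProductSpace.continuousLinearMapOfBilin_apply]
  rfl

/-- The operators `∫ F̄ V dμ` are Hilbert–Schmidt. For a finite set `s` of basis vectors and
`S = ∑ ‖A eⱼ‖²`, the orthogonal vectors `⟪A eⱼ, V(·) eⱼ⟫` of `L²(G)` have a sum of squared norm
`d⁻¹ S` whose inner product with `F` is `S`. -/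
theorem isHilbertSchmidt_smearedRep (F : Lp ℂ 2 μ) : IsHilbertSchmidt (smearedRep hd F) := by
  classical
  set A := smearedRep hd F
  set e := someBasis H
  refine summable_of_sum_le (c := d⁻¹ * ‖F‖ ^ 2) (fun _ => by positivity) fun s => ?_
  set S := ∑ j ∈ s, ‖A (e j)‖ ^ 2
  set y : Lp ℂ 2 μ := ∑ j ∈ s, coeffMap hd (A (e j)) (e j)
  have h1 : ⟪F, y⟫_ℂ = S := by
    simp only [y, S, inner_sum, ← inner_smearedRep, Complex.ofReal_sum]
    refine Finset.sum_congr rfl fun j _ => ?_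
    rw [Complex.ofReal_pow]
    exact inner_self_eq_norm_sq_to_K _
  have h2 : ⟪y, y⟫_ℂ = (d : ℂ)⁻¹ * S := by
    simp only [y, S, inner_sum, sum_inner, inner_coeffMap, Complex.ofReal_sum, Finset.mul_sum]
    refine Finset.sum_congr rfl fun j hj => ?_
    rw [Finset.sum_eq_single j]
    · rw [inner_self_eq_norm_sq_to_K, inner_self_eq_norm_sq_to_K (e j), e.orthonormal.1 j,
        Complex.ofReal_pow]
      simp
    · intro i _ hij
      rw [e.orthonormal.2 hij, mul_zero, mul_zero]
    · exact fun h => absurd hj h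
  have h3 : ‖y‖ ^ 2 = d⁻¹ * S := by
    rw [← Complex.ofReal_inj]
    push_cast
    rw [← h2]
    exact (inner_self_eq_norm_sq_to_K y).symm
  have hS : 0 ≤ S := Finset.sum_nonneg fun _ _ => by positivity
  have h4 : S ≤ ‖F‖ * ‖y‖ := by
    have := norm_inner_le_norm (𝕜 := ℂ) F y
    rw [h1, Complex.norm_real, Real.norm_of_nonneg hS] at this
    exact this
  have h5 : S * S ≤ (d⁻¹ * ‖F‖ ^ 2) * S := by
    calc S * S ≤ (‖F‖ * ‖y‖) * (‖F‖ * ‖y‖) := mul_self_le_mul_self hS h4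
      _ = ‖F‖ ^ 2 * ‖y‖ ^ 2 := by ring
      _ = _ := by rw [h3]; ring
  rcases hS.eq_or_lt with h | h
  · rw [← h]
    have := hd.pos
    positivity
  · exact le_of_mul_le_mul_right h5 h

/-- A pairwise orthogonal family with summable squared norms is summable. -/
theorem summable_of_pairwise_inner_eq_zero {ι E : Type*} [NormedAddCommGroup E]
    [InnerProductSpace ℂ E] [CompleteSpace E] {x : ι → E}
    (hx : Pairwise fun i j => ⟪x i, x j⟫_ℂ = 0) (hs : Summable fun i => ‖x i‖ ^ 2) :
    Summable x := by
  have h : OrthogonalFamily ℂ (fun i => Submodule.span ℂ {x i})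
      fun i => (Submodule.span ℂ {x i}).subtypeₗᵢ := by
    rintro i j hij ⟨v, hv⟩ ⟨w, hw⟩
    obtain ⟨a, rfl⟩ := Submodule.mem_span_singleton.mp hv
    obtain ⟨b, rfl⟩ := Submodule.mem_span_singleton.mp hw
    change ⟪a • x i, b • x j⟫_ℂ = 0
    rw [inner_smul_left, inner_smul_right, hx hij, mul_zero, mul_zero]
  exact (h.summable_iff_norm_sq_summable
    fun i => ⟨x i, Submodule.mem_span_singleton_self _⟩).mpr hs

theorem summable_coeffMap_smearedRep (F : Lp ℂ 2 μ) :
    Summable fun j => coeffMap hd (smearedRep hd F (someBasis H j)) (someBasis H j) := by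
  refine summable_of_pairwise_inner_eq_zero (fun i j hij => ?_) ?_
  · beta_reduce
    rw [inner_coeffMap, (someBasis H).orthonormal.2 hij, mul_zero, mul_zero]
  · simp only [norm_coeffMap, (someBasis H).orthonormal.1, mul_one, mul_pow]
    exact Summable.mul_left _ (isHilbertSchmidt_smearedRep hd F)

/-- The orthogonal projection of `F` onto the closed span of the coefficients in `L²(G)`, as the
series `d ∑ ⟪A eⱼ, V(·) eⱼ⟫` for `A = ∫ F̄ V dμ`. -/
noncomputable def coeffProjection (F : Lp ℂ 2 μ) : Lp ℂ 2 μ :=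
  (d : ℂ) • ∑' j, coeffMap hd (smearedRep hd F (someBasis H j)) (someBasis H j)

theorem hasSum_inner_coeffProjection (F h : Lp ℂ 2 μ) :
    HasSum (fun j => (d : ℂ) * ⟪h, coeffMap hd (smearedRep hd F (someBasis H j)) (someBasis H j)⟫_ℂ)
      ⟪h, coeffProjection hd F⟫_ℂ := by
  rw [coeffProjection, inner_smul_right]
  exact ((summable_coeffMap_smearedRep hd F).hasSum.mapL (innerSL ℂ h)).mul_left _

theorem inner_coeffProjection_coeffMap (F : Lp ℂ 2 μ) (u v : H) :
    ⟪coeffProjection hd F, coeffMap hd u v⟫_ℂ = ⟪F, coeffMap hd u v⟫_ℂ := by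
  rw [← inner_conj_symm, ← inner_conj_symm F]
  congr 1
  refine (hasSum_inner_coeffProjection hd F (coeffMap hd u v)).unique ?_
  have h := (someBasis H).hasSum_inner_mul_inner v ((smearedRep hd F).adjoint u)
  rw [ContinuousLinearMap.adjoint_inner_right, ← inner_conj_symm, inner_smearedRep,
    inner_conj_symm] at h
  refine h.congr_fun fun j => ?_
  have hd0 : (d : ℂ) ≠ 0 := by exact_mod_cast hd.pos.ne'
  rw [inner_coeffMap, ContinuousLinearMap.adjoint_inner_right, mul_inv_cancel_left₀ hd0, mul_comm]

/-- Pairing the projection of `F` with `h` is a trace: both sides expand as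
`d ∑ ⟪B eⱼ, A eⱼ⟫` for `A = ∫ F̄ V dμ` and `B = ∫ h̄ V dμ`. -/
theorem inner_coeffProjection_eq_opTrace (F h : Lp ℂ 2 μ) :
    ⟪coeffProjection hd F, h⟫_ℂ
      = d * opTrace ((smearedRep hd h).adjoint * smearedRep hd F) := by
  have h1 := (hasSum_inner_coeffProjection hd F h).tsum_eq
  simp only [← inner_smearedRep] at h1
  rw [← inner_conj_symm, ← h1, tsum_mul_left, map_mul, Complex.conj_ofReal]
  congr 1
  have h2 : ((smearedRep hd h).adjoint * smearedRep hd F)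
      = ((smearedRep hd F).adjoint * smearedRep hd h).adjoint := by
    simp [← ContinuousLinearMap.star_eq_adjoint]
  rw [h2, opTrace_adjoint]
  congr 1
  refine tsum_congr fun j => ?_
  exact (ContinuousLinearMap.adjoint_inner_right _ _ _).symm

/-- For `F = f̄` the operator `∫ F̄ V dμ` is the weak integral `∫ f V dμ`. -/
theorem isWeakIntegral_smearedRep {f : G → ℂ} (hf : MemLp f 2 μ) :
    IsWeakIntegral μ (fun g => f g • tomographicMap V g) (smearedRep hd (hf.star.toLp _)) := by
  intro φ ψ
  have h : (fun g => ⟪φ, (f g • tomographicMap V g) ψ⟫_ℂ)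
      = fun g => f g * ⟪φ, (V g : H →L[ℂ] H) ψ⟫_ℂ :=
    funext fun g => inner_smul_right _ _ _
  rw [h]
  refine ⟨hf.integrable_mul (hd.memLp φ ψ), ?_⟩
  rw [inner_smearedRep, L2.inner_def]
  refine integral_congr_ae ?_
  filter_upwards [coeFn_coeffMap hd φ ψ, hf.star.coeFn_toLp] with g h1 h2
  rw [h1, h2, RCLike.inner_apply, mul_comm]
  simp

/-- The weak integral `∫ h D dμ` of `D(g) = d V(g)†` is `d (∫ h̄ V dμ)†`. -/
theorem isWeakIntegral_dualMap {h : G → ℂ} (hh : MemLp h 2 μ) :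
    IsWeakIntegral μ (fun g => h g • dualMap V d g)
      ((d : ℂ) • (smearedRep hd (hh.toLp _)).adjoint) := by
  intro φ ψ
  have he : (fun g => ⟪φ, (h g • dualMap V d g) ψ⟫_ℂ)
      = fun g => (d : ℂ) * (h g * starRingEnd ℂ ⟪ψ, (V g : H →L[ℂ] H) φ⟫_ℂ) := funext fun g => by
    change ⟪φ, h g • ((d : ℂ) • (V g : H →L[ℂ] H).adjoint ψ)⟫_ℂ = _
    rw [inner_smul_right, inner_smul_right, ContinuousLinearMap.adjoint_inner_right,
      inner_conj_symm]
    ring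
  rw [he]
  refine ⟨(hh.integrable_mul (hd.memLp ψ φ).star).const_mul _, ?_⟩
  rw [_root_.smul_apply, inner_smul_right, ContinuousLinearMap.adjoint_inner_right,
    ← inner_conj_symm, inner_smearedRep, inner_conj_symm, L2.inner_def, integral_const_mul]
  congr 1
  refine integral_congr_ae ?_
  filter_upwards [coeFn_coeffMap hd ψ φ, hh.coeFn_toLp] with g h1 h2
  rw [h1, h2, RCLike.inner_apply]

/-- The kernel smeared with `f` is the complex conjugate of the projection of `f̄` onto the closed
span of the coefficients. -/
theorem isSmearedKernel_coeffProjection [TopologicalSpace G] [OpensMeasurableSpace G]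
    [SecondCountableTopology G] [IsFiniteMeasureOnCompacts μ] {f : G → ℂ} (hf : MemLp f 2 μ) :
    IsSmearedKernel μ (tomographicMap V) (dualMap V d) f
      (fun g => starRingEnd ℂ (coeffProjection hd (hf.star.toLp _) g)) := by
  refine ⟨(Lp.memLp (coeffProjection hd (hf.star.toLp _))).star, fun h hc hs => ?_⟩
  have hh : MemLp h 2 μ := hc.memLp_of_hasCompactSupport hs
  refine ⟨_, _, isWeakIntegral_smearedRep hd hf, isWeakIntegral_dualMap hd hh, ?_, ?_⟩
  · exact ((isHilbertSchmidt_smearedRep hd (hh.toLp _)).adjoint.mul_left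
      ((d : ℂ) • 1)).isTraceClass_mul (isHilbertSchmidt_smearedRep hd _) |> fun h => by simpa using h
  · have h1 := inner_coeffProjection_eq_opTrace hd (hf.star.toLp _) (hh.toLp _)
    have h2 : opTrace ((d : ℂ) • (smearedRep hd (hh.toLp _)).adjoint
        * smearedRep hd (hf.star.toLp _)) = d * opTrace ((smearedRep hd (hh.toLp _)).adjoint
        * smearedRep hd (hf.star.toLp _)) := by
      simp only [opTrace]
      rw [← tsum_mul_left]
      exact tsum_congr fun j => inner_smul_right _ _ _
    rw [h2, ← h1, L2.inner_def]
    refine integral_congr_ae ?_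
    filter_upwards [hh.coeFn_toLp] with g h3
    rw [h3, RCLike.inner_apply]

end Smearing

section NormalPair

variable {H : Type*} [NormedAddCommGroup H] [InnerProductSpace ℂ H] [CompleteSpace H]

theorem opTrace_dualMap_mul {G : Type*} [Group G] (V : G →* unitary (H →L[ℂ] H)) (d : ℝ) (g : G) (a : H →L[ℂ] H) :
    opTrace (dualMap V d g * a)
      = d * starRingEnd ℂ (opTrace (a.adjoint * (V g : H →L[ℂ] H))) := by
  rw [← opTrace_adjoint]
  have h2 : (a.adjoint * (V g : H →L[ℂ] H)).adjoint = (V g : H →L[ℂ] H).adjoint * a := by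
    simp [← ContinuousLinearMap.star_eq_adjoint]
  rw [h2]
  simp only [opTrace]
  rw [← tsum_mul_left]
  exact tsum_congr fun j => inner_smul_right _ _ _

theorem IsTraceClass.adjoint {a : H →L[ℂ] H} (ha : IsTraceClass a) : IsTraceClass a.adjoint := by
  obtain ⟨X, Y, hX, hY, rfl⟩ := ha.exists_eq_mul
  have h : (X * Y).adjoint = Y.adjoint * X.adjoint := star_mul X Y
  rw [h]
  exact hY.adjoint.isTraceClass_mul hX.adjoint

variable {G : Type*} [Group G] [MeasurableSpace G] {μ : Measure G}
  {V : G →* unitary (H →L[ℂ] H)} {d : ℝ}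

theorem IsFormalDegree.isNormalTomographicPair (hd : IsFormalDegree μ V d) [TopologicalSpace G]
    [OpensMeasurableSpace G] [SecondCountableTopology G] [IsFiniteMeasureOnCompacts μ] :
    IsNormalTomographicPair μ (tomographicMap V) (dualMap V d) where
  separates σ τ hσ hτ hst := by
    obtain ⟨h1, h2⟩ := hσ.isTraceClass.inner_coeffMap_opTrace hd
    obtain ⟨h3, h4⟩ := hτ.isTraceClass.inner_coeffMap_opTrace hd
    have h5 : h1.toLp _ = h3.toLp _ := MemLp.toLp_congr _ _ (ae_of_all _ hst)
    ext x
    refine ext_inner_left ℂ fun y => ?_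
    have h6 := h2 x y
    rw [h5, h4] at h6
    exact (mul_left_cancel₀ (inv_ne_zero (by exact_mod_cast hd.pos.ne')) h6).symm
  memLp σ hσ := (hσ.isTraceClass.inner_coeffMap_opTrace hd).choose
  dual_memLp a ha := by
    simp only [opTrace_dualMap_mul]
    exact (ha.adjoint.inner_coeffMap_opTrace hd).choose.star.const_mul _
  reproducing f hc hs := by
    have hf : MemLp f 2 μ := hc.memLp_of_hasCompactSupport hs
    refine ⟨_, isSmearedKernel_coeffProjection hd hf, fun σ hσ => ?_⟩
    obtain ⟨X, Y, hX, hY, rfl⟩ := hσ.isTraceClass.exists_eq_mul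
    obtain ⟨h1, h2⟩ := hX.exists_memLp_opTrace hd hY
    -- the projection of `f̄` and `f̄` itself pair in the same way with every coefficient, hence with
    -- the sampling function, which is a sum of coefficients
    have h3 := h2.mapL (innerSL ℂ (coeffProjection hd (hf.star.toLp _)))
    have h4 := h2.mapL (innerSL ℂ (hf.star.toLp _))
    simp only [innerSL_apply_apply, inner_coeffProjection_coeffMap] at h3 h4
    have h5 := h4.unique h3
    rw [L2.inner_def, L2.inner_def] at h5
    refine Eq.trans (integral_congr_ae ?_) (h5.trans (integral_congr_ae ?_))
    · filter_upwards [h1.coeFn_toLp, hf.star.coeFn_toLp] with g h6 h7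
      rw [h6, h7, RCLike.inner_apply, mul_comm]
      simp [smearedCharacter, tomographicMap]
    · filter_upwards [h1.coeFn_toLp] with g h6
      rw [h6, RCLike.inner_apply, mul_comm]
      rfl

theorem IsFormalDegree.frame_reproducing (hd : IsFormalDegree μ V d) {ψ₀ : H} (h₀ : ‖ψ₀‖ = 1) (φ ψ : H) :
    Integrable (fun g => (d * ⟪φ, (V g : H →L[ℂ] H) ψ₀⟫_ℂ) * ⟪(V g : H →L[ℂ] H) ψ₀, ψ⟫_ℂ) μ ∧
      ∫ g, (d * ⟪φ, (V g : H →L[ℂ] H) ψ₀⟫_ℂ) * ⟪(V g : H →L[ℂ] H) ψ₀, ψ⟫_ℂ ∂μ = ⟪φ, ψ⟫_ℂ := by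
  simp only [mul_assoc]
  refine ⟨((hd.memLp φ ψ₀).integrable_mul (hd.memLp_inner_left ψ ψ₀)).const_mul _, ?_⟩
  rw [integral_const_mul, hd.orthogonality, mul_inv_cancel_left₀ (by exact_mod_cast hd.pos.ne'),
    inner_self_eq_norm_sq_to_K, h₀]
  simp

end NormalPair

/-! ### Finite dimensional representations -/

section MatrixUnits

variable {H : Type*} [NormedAddCommGroup H] [InnerProductSpace ℂ H]

open InnerProductSpace (rankOne)

theorem sum_rankOne_eq {ι : Type*} [Fintype ι] (e : OrthonormalBasis ι ℂ H) (a : H →L[ℂ] H) :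
    ∑ j, rankOne ℂ (a (e j)) (e j) = a := by
  ext x
  conv_rhs => rw [← e.sum_repr' x, map_sum]
  rw [_root_.sum_apply]
  exact Finset.sum_congr rfl fun j _ => by rw [InnerProductSpace.rankOne_apply, map_smul]

/-- The expansion of an operator in matrix units. -/
theorem sum_inner_smul_rankOne {ι : Type*} [Fintype ι] (e : OrthonormalBasis ι ℂ H)
    (a : H →L[ℂ] H) : ∑ j, ∑ i, ⟪e i, a (e j)⟫_ℂ • rankOne ℂ (e i) (e j) = a := by
  conv_rhs => rw [← sum_rankOne_eq e a]
  refine Finset.sum_congr rfl fun j _ => ?_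
  conv_rhs => rw [← e.sum_repr' (a (e j))]
  simp only [map_sum, map_smul, _root_.sum_apply, _root_.smul_apply]

end MatrixUnits

section DualFunctional

variable {G : Type*} [Group G]
variable {H : Type*} [NormedAddCommGroup H] [InnerProductSpace ℂ H] [CompleteSpace H]
  {V : G →* unitary (H →L[ℂ] H)} {d : ℝ} [Fintype (basisIndex H)]

/-- The functional `a ↦ d Tr (V(g)† a)`, written out in the chosen basis as a finite sum of bounded
functionals. -/
noncomputable def dualFunctional (V : G →* unitary (H →L[ℂ] H)) (d : ℝ) (g : G) :
    StrongDual ℂ (H →L[ℂ] H) :=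
  (d : ℂ) • ∑ i, (innerSL ℂ ((V g : H →L[ℂ] H) (someBasis H i))) ∘L
    (ContinuousLinearMap.apply ℂ H (someBasis H i))

theorem dualFunctional_apply (g : G) (a : H →L[ℂ] H) :
    dualFunctional V d g a
      = d * ∑ i, ⟪(V g : H →L[ℂ] H) (someBasis H i), a (someBasis H i)⟫_ℂ := by
  simp [dualFunctional, _root_.sum_apply]

theorem dualFunctional_eq_opTrace (g : G) (a : H →L[ℂ] H) :
    dualFunctional V d g a = opTrace (dualMap V d g * a) := by
  rw [dualFunctional_apply, opTrace, tsum_fintype, Finset.mul_sum]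
  refine Finset.sum_congr rfl fun i _ => ?_
  rw [← ContinuousLinearMap.adjoint_inner_right, ← inner_smul_right]
  rfl

/-- The functionals `d Tr (V(g)† ·)` differ by unitary left multiplications, hence have equal norms. -/
theorem norm_dualFunctional_le (g h : G) : ‖dualFunctional V d g‖ ≤ ‖dualFunctional V d h‖ := by
  refine ContinuousLinearMap.opNorm_le_bound _ (norm_nonneg _) fun a => ?_
  have h1 : dualFunctional V d g a = dualFunctional V d h ((V (h * g⁻¹) : H →L[ℂ] H) * a) := by
    rw [dualFunctional_apply, dualFunctional_apply]
    congr 1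
    refine Finset.sum_congr rfl fun i _ => ?_
    rw [mul_apply_eq_comp, inner_rep_right, ← rep_mul_apply]
    simp
  rw [h1]
  refine (ContinuousLinearMap.le_opNorm _ _).trans
    (mul_le_mul_of_nonneg_left ?_ (norm_nonneg _))
  refine ContinuousLinearMap.opNorm_le_bound _ (norm_nonneg _) fun x => ?_
  rw [mul_apply_eq_comp, norm_rep_apply]
  exact a.le_opNorm x

end DualFunctional

section FiniteDim

variable {G : Type*} [Group G] [MeasurableSpace G] {μ : Measure G}
variable {H : Type*} [NormedAddCommGroup H] [InnerProductSpace ℂ H] [CompleteSpace H]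
  {V : G →* unitary (H →L[ℂ] H)} {d : ℝ}

open InnerProductSpace (rankOne)

theorem IsFormalDegree.memLp_linearMap {ι : Type*} [Fintype ι] (e : OrthonormalBasis ι ℂ H)
    (hd : IsFormalDegree μ V d) (L : (H →L[ℂ] H) →ₗ[ℂ] ℂ) :
    MemLp (fun g => L (V g : H →L[ℂ] H)) 2 μ := by
  have h : (fun g => L (V g : H →L[ℂ] H))
      = fun g => ∑ j, ∑ i, L (rankOne ℂ (e i) (e j)) * ⟪e i, (V g : H →L[ℂ] H) (e j)⟫_ℂ := by
    funext g
    conv_lhs => rw [← sum_inner_smul_rankOne e (V g : H →L[ℂ] H)]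
    simp only [map_sum, map_smul, smul_eq_mul, mul_comm]
  rw [h]
  exact memLp_finsetSum _ fun j _ => memLp_finsetSum _ fun i _ => (hd.memLp _ _).const_mul _

/-- The orthogonality relations for a linear functional of the representation. -/
theorem IsFormalDegree.integral_linearMap_mul {ι : Type*} [Fintype ι] (e : OrthonormalBasis ι ℂ H)
    (hd : IsFormalDegree μ V d) (L : (H →L[ℂ] H) →ₗ[ℂ] ℂ) (x y : H) :
    ∫ g, L (V g : H →L[ℂ] H) * ⟪(V g : H →L[ℂ] H) y, x⟫_ℂ ∂μ = (d : ℂ)⁻¹ * L (rankOne ℂ x y) := by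
  have h : (fun g => L (V g : H →L[ℂ] H) * ⟪(V g : H →L[ℂ] H) y, x⟫_ℂ)
      = fun g => ∑ j, ∑ i, L (rankOne ℂ (e i) (e j)) *
        (⟪e i, (V g : H →L[ℂ] H) (e j)⟫_ℂ * ⟪(V g : H →L[ℂ] H) y, x⟫_ℂ) := by
    funext g
    conv_lhs => rw [← sum_inner_smul_rankOne e (V g : H →L[ℂ] H)]
    simp only [map_sum, map_smul, smul_eq_mul, Finset.sum_mul]
    exact Finset.sum_congr rfl fun j _ => Finset.sum_congr rfl fun i _ => by
      rw [sum_inner_smul_rankOne]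
      ring
  have hint : ∀ i j, Integrable (fun g => L (rankOne ℂ (e i) (e j)) *
      (⟪e i, (V g : H →L[ℂ] H) (e j)⟫_ℂ * ⟪(V g : H →L[ℂ] H) y, x⟫_ℂ)) μ := fun i j =>
    ((hd.memLp _ _).integrable_mul (hd.memLp_inner_left x y)).const_mul _
  rw [h, integral_finsetSum _ fun j _ => integrable_finsetSum _ fun i _ => hint i j]
  simp only [integral_finsetSum _ fun i _ => hint i _, integral_const_mul, hd.orthogonality]
  conv_rhs => rw [← sum_inner_smul_rankOne e (rankOne ℂ x y)]
  simp only [map_sum, map_smul, smul_eq_mul, Finset.mul_sum, InnerProductSpace.rankOne_apply,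
    inner_smul_right]
  exact Finset.sum_congr rfl fun j _ => Finset.sum_congr rfl fun i _ => by ring

variable [Fintype (basisIndex H)]

/-- A group with a finite dimensional square integrable representation has finite Haar measure:
`∑ |⟪eᵢ, V(g) x⟫|² = 1` for unit vectors `x`. -/
theorem IsFormalDegree.isFiniteMeasure [Nontrivial H] (hd : IsFormalDegree μ V d) :
    IsFiniteMeasure μ := by
  obtain ⟨x, hx⟩ := exists_norm_eq H zero_le_one
  have h : Integrable (fun g => ∑ i, ‖⟪someBasis H i, (V g : H →L[ℂ] H) x⟫_ℂ‖ ^ 2) μ :=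
    integrable_finsetSum _ fun i _ =>
      (memLp_two_iff_integrable_sq_norm (hd.memLp _ _).1).mp (hd.memLp _ _)
  have h1 : ∀ g, ∑ i, ‖⟪someBasis H i, (V g : H →L[ℂ] H) x⟫_ℂ‖ ^ 2 = 1 := fun g => by
    rw [(hasSum_fintype _).unique (hasSum_sq_norm_inner (someBasis H) _), norm_rep_apply, hx,
      one_pow]
  simp only [h1] at h
  exact (integrable_const_iff.mp h).resolve_left one_ne_zero

/-- The reconstruction formula `∫ d Tr (V(g)† a) L(V(g)) dμ(g) = L a` for linear functionals `L`: the
orthogonality relations give `∫ d ⟪V(g) eᵢ, a eᵢ⟫ L(V(g)) dμ(g) = L |a eᵢ⟩⟨eᵢ|`, and these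
rank one operators add up to `a`. -/
theorem IsFormalDegree.integrable_and_integral_dualFunctional (hd : IsFormalDegree μ V d)
    (L : (H →L[ℂ] H) →ₗ[ℂ] ℂ) (a : H →L[ℂ] H) :
    Integrable (fun g => dualFunctional V d g a * L (V g : H →L[ℂ] H)) μ ∧
      ∫ g, dualFunctional V d g a * L (V g : H →L[ℂ] H) ∂μ = L a := by
  let e : OrthonormalBasis (basisIndex H) ℂ H := (someBasis H).toOrthonormalBasis
  have he : ∀ i, e i = someBasis H i := fun i => by simp [e]
  have h : (fun g => dualFunctional V d g a * L (V g : H →L[ℂ] H))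
      = fun g => ∑ i, (d : ℂ) * (L (V g : H →L[ℂ] H) * ⟪(V g : H →L[ℂ] H) (e i), a (e i)⟫_ℂ) := by
    funext g
    rw [dualFunctional_apply, mul_assoc, Finset.sum_mul, Finset.mul_sum]
    exact Finset.sum_congr rfl fun i _ => by rw [he, mul_comm (L _)]
  have hint : ∀ i, Integrable (fun g => (d : ℂ) *
      (L (V g : H →L[ℂ] H) * ⟪(V g : H →L[ℂ] H) (e i), a (e i)⟫_ℂ)) μ := fun i =>
    ((hd.memLp_linearMap e L).integrable_mul (hd.memLp_inner_left _ _)).const_mul _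
  have hd0 : (d : ℂ) ≠ 0 := by exact_mod_cast hd.pos.ne'
  rw [h]
  refine ⟨integrable_finsetSum _ fun i _ => hint i, ?_⟩
  rw [integral_finsetSum _ fun i _ => hint i]
  simp only [integral_const_mul, hd.integral_linearMap_mul e, mul_inv_cancel_left₀ hd0]
  rw [← map_sum, sum_rankOne_eq]

theorem IsFormalDegree.isTomographicPair [Nontrivial H] (hd : IsFormalDegree μ V d) :
    IsTomographicPair μ (tomographicMap V) (dualFunctional V d) where
  tomographicMap :=
    { memLp := fun ρ _ => hd.memLp_linearMap (someBasis H).toOrthonormalBasis ρ.toLinearMap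
      separates := fun ρ τ _ _ h => by
        refine PositiveLinearMap.ext fun a => ?_
        have h1 := (hd.integrable_and_integral_dualFunctional ρ.toLinearMap a).2
        have h2 := (hd.integrable_and_integral_dualFunctional τ.toLinearMap a).2
        refine h1.symm.trans (Eq.trans ?_ h2)
        congr 1
        funext g
        exact congrArg _ (h g) }
  norm_memLp := by
    have := hd.isFiniteMeasure
    have h : (fun g => ‖dualFunctional V d g‖) = fun _ => ‖dualFunctional V d 1‖ :=
      funext fun g => le_antisymm (norm_dualFunctional_le g 1) (norm_dualFunctional_le 1 g)
    rw [h]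
    exact memLp_const _
  reproducing ρ _ g :=
    hd.integrable_and_integral_dualFunctional ρ.toLinearMap (V g : H →L[ℂ] H)

theorem IsFormalDegree.isNormalized (hd : IsFormalDegree μ V d) :
    IsNormalized μ (tomographicMap V) (dualFunctional V d) := fun ρ hρ => by
  have h := (hd.integrable_and_integral_dualFunctional ρ.toLinearMap 1).2
  simp_rw [mul_comm (dualFunctional V d _ _)] at h
  exact h.trans hρ

end FiniteDim

end GroupTomography

theorem mainTheorem6
    {E : Type*} [NormedAddCommGroup E] [NormedSpace ℝ E] [FiniteDimensional ℝ E]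
    {G : Type*} [Group G] [TopologicalSpace G] [T2Space G] [SecondCountableTopology G]
    [ChartedSpace E G] [LieGroup 𝓘(ℝ, E) ∞ G]
    [MeasurableSpace G] [BorelSpace G]
    (μ : Measure G) [μ.IsHaarMeasure] [μ.IsMulRightInvariant]
    {A : Type*} [CStarAlgebra A] [PartialOrder A] [StarOrderedRing A]
    (U : G →* unitary A)
    (ρ₀ : A →ₚ[ℂ] ℂ) (hρ₀ : GroupTomography.IsState ρ₀)
    (hcont : ∀ ψ : ρ₀.GNS,
      Continuous fun g => (GroupTomography.gnsRep ρ₀ U g : ρ₀.GNS →L[ℂ] ρ₀.GNS) ψ)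
    (hsq : GroupTomography.IsSquareIntegrableRep μ (GroupTomography.gnsRep ρ₀ U)) :
    ∃ d : ℝ, GroupTomography.IsFormalDegree μ (GroupTomography.gnsRep ρ₀ U) d ∧
      -- `U₀`, `D₀` is a tomographic pair for the normal states of `B(H_{ρ₀})`
      GroupTomography.IsNormalTomographicPair μ
        (GroupTomography.tomographicMap (GroupTomography.gnsRep ρ₀ U))
        (GroupTomography.dualMap (GroupTomography.gnsRep ρ₀ U) d) ∧
      -- the associated frame kernels are reproducing pointwise
      (∀ ψ₀ ψ : ρ₀.GNS, ‖ψ₀‖ = 1 → ∀ g : G,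
        Integrable (fun g' : G =>
          (d * ⟪(GroupTomography.gnsRep ρ₀ U g : ρ₀.GNS →L[ℂ] ρ₀.GNS) ψ₀,
              (GroupTomography.gnsRep ρ₀ U g' : ρ₀.GNS →L[ℂ] ρ₀.GNS) ψ₀⟫_ℂ) *
            ⟪(GroupTomography.gnsRep ρ₀ U g' : ρ₀.GNS →L[ℂ] ρ₀.GNS) ψ₀, ψ⟫_ℂ) μ ∧
        ∫ g' : G,
          (d * ⟪(GroupTomography.gnsRep ρ₀ U g : ρ₀.GNS →L[ℂ] ρ₀.GNS) ψ₀,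
              (GroupTomography.gnsRep ρ₀ U g' : ρ₀.GNS →L[ℂ] ρ₀.GNS) ψ₀⟫_ℂ) *
            ⟪(GroupTomography.gnsRep ρ₀ U g' : ρ₀.GNS →L[ℂ] ρ₀.GNS) ψ₀, ψ⟫_ℂ ∂μ
          = ⟪(GroupTomography.gnsRep ρ₀ U g : ρ₀.GNS →L[ℂ] ρ₀.GNS) ψ₀, ψ⟫_ℂ) ∧
      -- if `H_{ρ₀}` is finite dimensional, `D₀` takes values in the dual of `B(H_{ρ₀})` and the
      -- pair is a normalized tomographic pair of the C*-algebra `B(H_{ρ₀})`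
      (FiniteDimensional ℂ ρ₀.GNS →
        ∃ D : G → StrongDual ℂ (ρ₀.GNS →L[ℂ] ρ₀.GNS),
          (∀ g a, D g a =
            GroupTomography.opTrace (GroupTomography.dualMap (GroupTomography.gnsRep ρ₀ U) d g * a)) ∧
          GroupTomography.IsTomographicPair μ
            (GroupTomography.tomographicMap (GroupTomography.gnsRep ρ₀ U)) D ∧
          GroupTomography.IsNormalized μ
            (GroupTomography.tomographicMap (GroupTomography.gnsRep ρ₀ U)) D) := by
  have : IsTopologicalGroup G := topologicalGroup_of_lieGroup 𝓘(ℝ, E) ∞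
  have : LocallyCompactSpace G := Manifold.locallyCompact_of_finiteDimensional 𝓘(ℝ, E)
  have : μ.IsInvInvariant := GroupTomography.isInvInvariant_of_isMulRightInvariant μ
  have : Nontrivial ρ₀.GNS := hsq.1.1
  obtain ⟨d, hd⟩ := hsq.exists_isFormalDegree hcont
  refine ⟨d, hd, hd.isNormalTomographicPair, fun ψ₀ ψ h₀ g => hd.frame_reproducing h₀ _ ψ,
    fun _ => ?_⟩
  have : Finite (GroupTomography.basisIndex ρ₀.GNS) :=
    (GroupTomography.someBasis ρ₀.GNS).orthonormal.linearIndependent.finite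
  have := Fintype.ofFinite (GroupTomography.basisIndex ρ₀.GNS)
  exact ⟨GroupTomography.dualFunctional (GroupTomography.gnsRep ρ₀ U) d,
    GroupTomography.dualFunctional_eq_opTrace, hd.isTomographicPair, hd.isNormalized⟩
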